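/- Let $H$ be a separable real Hilbert space, $A:D(A)\subset H\to H$ the infinitesimal generator of a strongly continuous semigroup $(e^{tA})_{t\ge 0}$ on $H$, and $Q$ a bounded, symmetric, nonnegative operator on $H$ such that $Q_t x=\int_0^t e^{sA}Qe^{sA^*}x\,ds$ has finite trace for every $t>0$. Let $C_b(H)$ be the set of bounded uniformly continuous functions $H\to\mathbb R$, let $N_{Q_t}$ be the Gaussian measure on $H$ with mean $0$ and covariance operator $Q_t$, and let $R_t\varphi(x)=\int_H\varphi(e^{tA}x+y)\,N_{Q_t}(dy)$, $t\ge 0$, be the Ornstein–Uhlenbeck semigroup on $C_b(H)$. Its generator $(L,D(L))$ is defined as follows: $\varphi\in C_b(H)$ belongs to $D(L)$ if there is $g\in C_b(H)$ with $\lim_{t\to0^+}\frac{R_t\varphi(x)-\varphi(x)}{t}=g(x)$ for all $x\in H$, and $\sup_{t\in(0,1)}\big\|\frac{R_t\varphi-\varphi}{t}\big\|_\infty<\infty$; then $L\varphi=g$. A sequence $(\varphi_n)\subset C_b(H)$ is $\pi$-convergent to $\varphi\in C_b(H)$ if $\varphi_n\to\varphi$ pointwise and $\sup_n\|\varphi_n\|_\infty<\infty$.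 An $m$-indexed sequence ($m\ge1$) satisfies $\lim_{n_1}\cdots\lim_{n_m}\varphi_{n_1,\dots,n_m}\stackrel{\pi}{=}\varphi$ if the iterated limits, taken in $n_m,\dots,n_1$ successively, all exist as $\pi$-limits in $C_b(H)$ and the last one is $\varphi$. A set $D\subset C_b(H)$ is $\pi$-dense in $C_b(H)$ if every $\varphi\in C_b(H)$ is such an iterated $\pi$-limit of an $m$-indexed sequence in $D$, for some $m$. A set $D\subset D(L)$ is a $\pi$-core for $(L,D(L))$ if it is $\pi$-dense in $C_b(H)$ and for every $\varphi\in D(L)$ there are $m\ge 1$ and an $m$-indexed sequence in $D$ with $\lim_{n_1}\cdots\lim_{n_m}\varphi_{n_1,\dots,n_m}\stackrel{\pi}{=}\varphi$ and $\lim_{n_1}\cdots\lim_{n_m}L\varphi_{n_1,\dots,n_m}\stackrel{\pi}{=}L\varphi$. Let $\mathcal I_A(H)$ be the real linear span of the real and imaginary parts of the functions $$x\mapsto\int_0^a e^{\,i\langle e^{sA}x,h\rangle-\frac12\langle Q_sh,h\rangle}\,ds,\qquad a>0,\ h\in D(A^*).$$ Then $\mathcal I_A(H)$ is contained and $\pi$-dense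 in $C_b(H)$, $R_t(\mathcal I_A(H))\subset\mathcal I_A(H)$ for all $t\ge0$, and $\mathcal I_A(H)\subset D(L)$. Moreover $\mathcal I_A(H)$ is a $\pi$-core for $(L,D(L))$. Finally, every $\varphi\in\mathcal I_A(H)$ is twice Fréchet differentiable, and for every $x\in H$ the operator $QD^2\varphi(x)$ is of trace class, $D\varphi(x)\in D(A^*)$, and $$L\varphi(x)=\tfrac12\operatorname{Tr}[QD^2\varphi(x)]+\langle x,A^*D\varphi(x)\rangle .$$ -/

import Mathlib

open MeasureTheory ProbabilityTheory Filter Topology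
open scoped RealInnerProductSpace

universe u

noncomputable section

namespace OrnsteinUhlenbeck

/-! ### Bounded uniformly continuous functions and π-convergence -/

section PiConvergence

variable {H : Type u} [NormedAddCommGroup H]

/-- The set `C_b(H)` of all bounded, uniformly continuous functions `H → ℝ`. -/
def Cb (H : Type u) [NormedAddCommGroup H] : Set (H → ℝ) :=
  {φ | UniformContinuous φ ∧ ∃ C : ℝ, ∀ x, |φ x| ≤ C}

/-- π-convergence of a sequence in `C_b(H)` to an element of `C_b(H)`: pointwise convergence
together with a uniform bound on the sup norms. -/
def PiTendsto (φ : ℕ → H → ℝ) (f : H → ℝ) : Prop :=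
  (∀ n, φ n ∈ Cb H) ∧ f ∈ Cb H ∧ (∀ x, Tendsto (fun n => φ n x) atTop (𝓝 (f x))) ∧
    ∃ C : ℝ, ∀ n x, |φ n x| ≤ C

/-- π-convergence `lim_{n₁} ⋯ lim_{n_m} φ_{n₁,…,n_m} = f` of an `m`-indexed sequence: the limits
in `n_m, …, n₁` are taken one after the other, each of them in the sense of `PiTendsto`,
the partial limits being elements of `C_b(H)`. (Here `m ≥ 1`; the value at `m = 0` only
starts the recursion.) -/
def MultiPiTendsto : (m : ℕ) → ((Fin m → ℕ) → H → ℝ) → (H → ℝ) → Prop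
  | 0, φ, f => φ Fin.elim0 = f
  | m + 1, φ, f => ∃ ψ : ℕ → H → ℝ,
      (∀ k : ℕ, MultiPiTendsto m (fun ν => φ (Fin.cons k ν)) (ψ k)) ∧ PiTendsto ψ f

/-- The π-closure of a set of functions. -/
def piClosure (D : Set (H → ℝ)) : Set (H → ℝ) :=
  {f | ∃ m : ℕ, 0 < m ∧ ∃ φ : (Fin m → ℕ) → H → ℝ, (∀ ν, φ ν ∈ D) ∧ MultiPiTendsto m φ f}

/-- `D ⊆ C_b(H)` is π-dense in `C_b(H)`. -/
def IsPiDense (D : Set (H → ℝ)) : Prop :=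
  D ⊆ Cb H ∧ piClosure D = Cb H

/-- The domain of the infinitesimal generator of a family `P` of operators on functions. -/
def genDomain (P : ℝ → (H → ℝ) → H → ℝ) : Set (H → ℝ) :=
  {φ | φ ∈ Cb H ∧
    (∃ g ∈ Cb H, ∀ x, Tendsto (fun t : ℝ => (P t φ x - φ x) / t) (𝓝[>] 0) (𝓝 (g x))) ∧
    ∃ C : ℝ, ∀ t ∈ Set.Ioo (0 : ℝ) 1, ∀ x, |(P t φ x - φ x) / t| ≤ C}

/-- The infinitesimal generator of `P`; it is meaningful on `genDomain P`, where the limit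
exists. -/
def gen (P : ℝ → (H → ℝ) → H → ℝ) (φ : H → ℝ) : H → ℝ :=
  fun x => limUnder (𝓝[>] (0 : ℝ)) (fun t : ℝ => (P t φ x - φ x) / t)

/-- `D` is a π-core for the infinitesimal generator of `P`. -/
def IsPiCore (P : ℝ → (H → ℝ) → H → ℝ) (D : Set (H → ℝ)) : Prop :=
  D ⊆ genDomain P ∧ IsPiDense D ∧
    ∀ φ ∈ genDomain P, ∃ m : ℕ, 0 < m ∧ ∃ ψ : (Fin m → ℕ) → H → ℝ, (∀ ν, ψ ν ∈ D) ∧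
      MultiPiTendsto m ψ φ ∧ MultiPiTendsto m (fun ν => gen P (ψ ν)) (gen P φ)

end PiConvergence

/-! ### Strongly continuous semigroups, trace class operators, Gaussian measures -/

section Hilbert

variable {H : Type u} [NormedAddCommGroup H] [InnerProductSpace ℝ H]

/-- A strongly continuous semigroup `(e^{tA})_{t ≥ 0}` of bounded linear operators. The
values at negative times are irrelevant and never used. -/
structure C0Semigroup (H : Type u) [NormedAddCommGroup H] [InnerProductSpace ℝ H] where
  /-- The operator at time `t`. -/
  op : ℝ → H →L[ℝ] H
  op_zero : op 0 = ContinuousLinearMap.id ℝ H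
  op_add : ∀ s t : ℝ, 0 ≤ s → 0 ≤ t → op (s + t) = (op s).comp (op t)
  continuousOn_op : ∀ x : H, ContinuousOn (fun t => op t x) (Set.Ici 0)

/-- The domain `D(A)` of the infinitesimal generator `A` of a strongly continuous semigroup. -/
def C0Semigroup.domain (S : C0Semigroup H) : Submodule ℝ H where
  carrier := {x | ∃ y, Tendsto (fun t : ℝ => t⁻¹ • (S.op t x - x)) (𝓝[>] 0) (𝓝 y)}
  zero_mem' := ⟨0, by simp⟩
  add_mem' := by
    rintro x x' ⟨y, hy⟩ ⟨y', hy'⟩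
    refine ⟨y + y', (hy.add hy').congr fun t => ?_⟩
    rw [← smul_add, map_add, add_sub_add_comm]
  smul_mem' := by
    rintro c x ⟨y, hy⟩
    refine ⟨c • y, (hy.const_smul c).congr fun t => ?_⟩
    rw [map_smul, ← smul_sub, smul_comm]

/-- The infinitesimal generator `A x = lim_{t → 0+} (e^{tA} x - x) / t`, as an unbounded
operator with domain `D(A)`. -/
def C0Semigroup.generator (S : C0Semigroup H) : H →ₗ.[ℝ] H where
  domain := S.domain
  toFun :=
    { toFun := fun x => Classical.choose x.2
      map_add' := by
        intro x x'
        refine tendsto_nhds_unique (Classical.choose_spec (x + x').2)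
          (((Classical.choose_spec x.2).add (Classical.choose_spec x'.2)).congr fun t => ?_)
        rw [← smul_add, Submodule.coe_add, map_add, add_sub_add_comm]
      map_smul' := by
        intro c x
        refine tendsto_nhds_unique (Classical.choose_spec (c • x).2)
          (((Classical.choose_spec x.2).const_smul c).congr fun t => ?_)
        rw [Submodule.coe_smul, map_smul, ← smul_sub, smul_comm] }

/-- An operator `T` on `H` is of trace class: `∑ |⟨T e_i, f_i⟩| < ∞` for all orthonormal
families `(e_i)`, `(f_i)`. For a nonnegative symmetric `T` this says exactly that the trace
`∑ ⟨T e_i, e_i⟩` is finite. -/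
def IsTraceClass (T : H → H) : Prop :=
  ∀ (ι : Type u) (e f : ι → H), Orthonormal ℝ e → Orthonormal ℝ f →
    Summable fun i => |⟪T (e i), f i⟫|

/-- A centered Gaussian measure on `H` with covariance operator `T`. -/
def IsCenteredGaussian [MeasurableSpace H] (T : H → H) (μ : Measure H) : Prop :=
  IsGaussian μ ∧ (∀ h : H, ∫ y, ⟪y, h⟫ ∂μ = 0) ∧
    ∀ h k : H, ∫ y, ⟪y, h⟫ * ⟪y, k⟫ ∂μ = ⟪T h, k⟫

open Classical in
/-- The Gaussian measure `N_T` on `H` with mean zero and covariance operator `T`. (It exists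
whenever `T` is bounded, symmetric, nonnegative and of trace class, and it is unique, see
`IsCenteredGaussian.unique`; the value is `0` if there is none.) -/
def gaussianN [MeasurableSpace H] (T : H → H) : Measure H :=
  if h : ∃ μ : Measure H, IsCenteredGaussian T μ then Classical.choose h else 0

variable [CompleteSpace H]

/-- The trace `∑ ⟨T e_i, e_i⟩` over a Hilbert basis; for a trace class operator it does not
depend on the basis. -/
def trace (T : H → H) : ℝ :=
  ∑' i, ⟪T ((exists_hilbertBasis ℝ H).choose_spec.choose i),
    (exists_hilbertBasis ℝ H).choose_spec.choose i⟫

/-- The operators `Q_t x = ∫_0^t e^{sA} Q e^{sA*} x ds`. -/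
def covOp (S : C0Semigroup H) (Q : H →L[ℝ] H) (t : ℝ) (x : H) : H :=
  ∫ s in (0 : ℝ)..t, S.op s (Q (ContinuousLinearMap.adjoint (S.op s) x))

/-- The Ornstein–Uhlenbeck semigroup `R_t φ(x) = ∫ φ(e^{tA} x + y) N_{Q_t}(dy)`. -/
def ouSemigroup [MeasurableSpace H] (S : C0Semigroup H) (Q : H →L[ℝ] H)
    (t : ℝ) (φ : H → ℝ) : H → ℝ :=
  fun x => ∫ y, φ (S.op t x + y) ∂(gaussianN (covOp S Q t))

/-- The function `x ↦ ∫_0^a exp(i⟨e^{sA} x, h⟩ - ½⟨Q_s h, h⟩) ds`. -/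
def expInt (S : C0Semigroup H) (Q : H →L[ℝ] H) (a : ℝ) (h x : H) : ℂ :=
  ∫ s in (0 : ℝ)..a,
    Complex.exp (Complex.I * (⟪S.op s x, h⟫ : ℝ) - (1 / 2 : ℂ) * (⟪covOp S Q s h, h⟫ : ℝ))

/-- The space `I_A(H)`: the real linear span of the real and imaginary parts of the functions
`expInt S Q a h` with `a > 0` and `h ∈ D(A*)`. -/
def IA (S : C0Semigroup H) (Q : H →L[ℝ] H) : Submodule ℝ (H → ℝ) :=
  Submodule.span ℝ {φ | ∃ a : ℝ, 0 < a ∧ ∃ h ∈ S.generator.adjoint.domain,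
    (φ = fun x => (expInt S Q a h x).re) ∨ (φ = fun x => (expInt S Q a h x).im)}

end Hilbert

/-- A centered Gaussian measure is determined by its covariance operator. -/
theorem IsCenteredGaussian.unique {H : Type u} [NormedAddCommGroup H] [InnerProductSpace ℝ H]
    [CompleteSpace H] [TopologicalSpace.SeparableSpace H] [MeasurableSpace H] [BorelSpace H]
    {T : H → H} {μ ν : Measure H}
    (hμ : IsCenteredGaussian T μ) (hν : IsCenteredGaussian T ν) : μ = ν := by
  have : SecondCountableTopology H := UniformSpace.secondCountable_of_separable H
  have key : ∀ ρ : Measure H, IsCenteredGaussian T ρ → ∀ t : H,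
      charFun ρ t = Complex.exp (-(⟪T t, t⟫ : ℝ) / 2) := by
    rintro ρ ⟨hg, hm, hc⟩ t
    have := hg
    have h1 : ∫ y, ⟪t, y⟫ ∂ρ = 0 := by simpa only [real_inner_comm] using hm t
    rw [IsGaussian.charFun_eq, integral_complex_ofReal, h1, variance_of_integral_eq_zero
      (by fun_prop) h1]
    have h2 : ∫ y, ⟪t, y⟫ ^ 2 ∂ρ = ⟪T t, t⟫ := by
      rw [← hc t t]; congr 1; ext y; rw [sq, real_inner_comm]
    rw [h2]; congr 1; push_cast; ring
  have := hμ.1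
  have := hν.1
  exact Measure.ext_of_charFun (funext fun t => by rw [key μ hμ, key ν hν])

end OrnsteinUhlenbeck

end

open OrnsteinUhlenbeck

/-! The functions spanning I_A(H) are time integrals of orbits of the semigroup. The characteristic
function of N_{Q_s} gives R_s cos(⟨·,h⟩ + θ) = exp(-⟨Q_s h,h⟩/2) cos(⟨·,e^{sA*}h⟩ + θ), so the
generators are ∫_0^a R_s p ds with p a cosine of frequency h ∈ D(A*) (`HasGaussians.ou_trig`,
`HasGaussians.integratedOU_trig`). The semigroup law on such cosines turns R_t ∫_0^a into ∫_t^{a+t},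
which gives invariance. It also gives L ∫_0^a R_s p ds = R_a p - p (`HasGaussians.hasGen_cosInt`).
The right side is bounded, although a cosine itself need not lie in D(L), because ⟨x,A*h⟩ is
unbounded in x.

Trigonometric polynomials with frequencies in the dense subspace D(A*) are sequentially π-dense in
C_b(H) (`exists_trigSpan_piTendsto`). This rests on Stone–Weierstrass on finite-dimensional balls,
with truncation and orthogonal projections. Averaging over [0,1/k] moves them into I_A(H). For φ ∈
D(L) and p_n → φ, the averages k∫_0^{1/k} R_s p_n ds converge to φ, first in n and then in k. Their
images k(R_{1/k}p_n - p_n) tend in n to k(R_{1/k}φ - φ), and then in k to Lφ by the definition of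
D(L).

For the explicit formula, differentiation under the integral gives the gradient and the Hessian. The
s-derivative of R_s p(x) is ½Tr[QD²R_s p(x)] + ⟨x,A*DR_s p(x)⟩ (`hasDerivAt_dampedCos`), and
integrating it over [0,a] recovers R_a p - p = L∫_0^a R_s p ds.

Two supporting facts are proved along the way: N_{Q_t} exists, as the law of an L²-convergent
Gaussian series, and A* is densely defined with a strongly continuous adjoint semigroup. -/

noncomputable section

namespace OrnsteinUhlenbeck

/-! ### Existence of Gaussian measures with trace class covariance. -/

section GaussianExistence

/-- A semi-inner product on a real vector space is the pullback of the inner product of a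
Hilbert space. -/
theorem exists_linearMap_inner_eq {F : Type u} [AddCommGroup F] [Module ℝ F]
    (c : PreInnerProductSpace.Core ℝ F) :
    ∃ (K : Type u) (_ : NormedAddCommGroup K) (_ : InnerProductSpace ℝ K) (_ : CompleteSpace K)
      (j : F →ₗ[ℝ] K), ∀ x y, ⟪j x, j y⟫ = c.inner x y := by
  -- The form may be degenerate; the completion is separated, so it identifies null vectors with
  -- zero.
  let _ : SeminormedAddCommGroup F := InnerProductSpace.Core.toSeminormedAddCommGroup (c := c)
  let _ : InnerProductSpace ℝ F := InnerProductSpace.ofCore c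
  refine ⟨UniformSpace.Completion F, inferInstance, inferInstance, inferInstance,
    (UniformSpace.Completion.toComplL (𝕜 := ℝ) (E := F)).toLinearMap, fun x y => ?_⟩
  exact UniformSpace.Completion.inner_coe x y

variable {H : Type u} [NormedAddCommGroup H] [InnerProductSpace ℝ H]

/-- Every positive operator factors as `j† j` through some Hilbert space. -/
theorem exists_factorization (T : H →L[ℝ] H) (hT : T.IsPositive) :
    ∃ (K : Type u) (_ : NormedAddCommGroup K) (_ : InnerProductSpace ℝ K) (_ : CompleteSpace K)
      (j : H →L[ℝ] K), ∀ x y, ⟪j x, j y⟫ = ⟪T x, y⟫ := by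
  obtain ⟨K, i1, i2, i3, j, hj⟩ := exists_linearMap_inner_eq (F := H)
    { inner := fun x y => ⟪T x, y⟫
      conj_inner_symm := fun x y => by
        have := hT.inner_left_eq_inner_right y x
        simp only [conj_trivial]
        rw [this, real_inner_comm]
      re_inner_nonneg := fun x => by simpa using hT.inner_nonneg_left x
      add_left := fun x y z => by simp [inner_add_left]
      smul_left := fun x y r => by simp [inner_smul_left] }
  refine ⟨K, i1, i2, i3, j.mkContinuous (Real.sqrt ‖T‖) fun x => ?_, fun x y => hj x y⟩
  have h1 : ‖j x‖ ^ 2 = ⟪T x, x⟫ := by rw [← real_inner_self_eq_norm_sq]; exact hj x x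
  have h2 : ⟪T x, x⟫ ≤ (Real.sqrt ‖T‖ * ‖x‖) ^ 2 := by
    rw [mul_pow, Real.sq_sqrt (norm_nonneg _)]
    calc ⟪T x, x⟫ ≤ ‖T x‖ * ‖x‖ := real_inner_le_norm _ _
      _ ≤ ‖T‖ * ‖x‖ * ‖x‖ := by gcongr; exact T.le_opNorm x
      _ = _ := by ring
  exact abs_le_of_sq_le_sq' (h1 ▸ h2) (by positivity) |>.2

variable [CompleteSpace H]

/-- A positive trace class operator is a sum of rank one operators `⟨·, v i⟩ v i`. -/
theorem exists_hasSum_sq_inner (T : H →L[ℝ] H) (hT : T.IsPositive) (hTc : IsTraceClass T) :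
    ∃ (ι : Type u) (v : ι → H), Summable (fun i => ‖v i‖ ^ 2) ∧
      ∀ h, HasSum (fun i => ⟪v i, h⟫ ^ 2) ⟪T h, h⟫ := by
  obtain ⟨K, _, _, _, j, hj⟩ := exists_factorization T hT
  obtain ⟨w, b, -⟩ := exists_hilbertBasis ℝ K
  obtain ⟨w', e, -⟩ := exists_hilbertBasis ℝ H
  have hv : ∀ (i : w) (h : H), ⟪ContinuousLinearMap.adjoint j (b i), h⟫ = ⟪b i, j h⟫ :=
    fun i h => ContinuousLinearMap.adjoint_inner_left _ _ _
  have key : ∀ h, HasSum (fun i => ⟪b i, j h⟫ ^ 2) ⟪T h, h⟫ := fun h => by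
    have := b.hasSum_inner_mul_inner (j h) (j h)
    rw [hj] at this
    refine this.congr_fun fun i => ?_
    rw [real_inner_comm (j h) (b i), sq]
  refine ⟨w, fun i => ContinuousLinearMap.adjoint j (b i), ?_, fun h => ?_⟩
  · have h1 : Summable fun p : w' × w => ⟪b p.2, j (e p.1)⟫ ^ 2 := by
      refine (summable_prod_of_nonneg fun _ => sq_nonneg _).2
        ⟨fun k => (key (e k)).summable, ?_⟩
      simp_rw [fun k => (key (e k)).tsum_eq]
      exact (hTc w' e e e.orthonormal e.orthonormal).of_abs
    have h2 := ((summable_prod_of_nonneg fun _ => sq_nonneg _).1 h1.prod_symm).2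
    refine h2.congr fun i => ?_
    have := e.hasSum_inner_mul_inner (ContinuousLinearMap.adjoint j (b i))
      (ContinuousLinearMap.adjoint j (b i))
    rw [← real_inner_self_eq_norm_sq, ← this.tsum_eq]
    refine tsum_congr fun k => ?_
    rw [real_inner_comm _ (e k), hv, sq]; rfl
  · simpa only [hv] using key h

variable [MeasurableSpace H] [BorelSpace H]

/-- Measures with characteristic function `exp (-⟨T h, h⟩ / 2)` are centered Gaussian. -/
theorem isCenteredGaussian_of_charFun (T : H →L[ℝ] H) (hT : T.IsPositive) (μ : Measure H)
    [IsProbabilityMeasure μ]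
    (hμ : ∀ h, charFun μ h = Complex.exp (-(⟪T h, h⟫ : ℝ) / 2)) :
    IsCenteredGaussian T μ := by
  have hmap : ∀ h, μ.map (fun y => ⟪y, h⟫) = gaussianReal 0 (⟪T h, h⟫).toNNReal := fun h => by
    have : IsProbabilityMeasure (μ.map (fun y => ⟪y, h⟫)) :=
      Measure.isProbabilityMeasure_map (by fun_prop)
    refine Measure.ext_of_charFun (funext fun r => ?_)
    have h1 : charFun (μ.map (fun y => ⟪y, h⟫)) r = charFun μ (r • h) := by
      rw [charFun_apply, charFun_apply, integral_map (by fun_prop) (by fun_prop)]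
      congr 1; ext y
      simp [real_inner_smul_right]
    rw [h1, hμ, charFun_gaussianReal]
    simp only [map_smul, real_inner_smul_left, real_inner_smul_right]
    rw [Real.coe_toNNReal _ (hT.inner_nonneg_left h)]
    congr 1; push_cast; ring
  have hint : ∀ h, ∫ y, ⟪y, h⟫ ∂μ = 0 := fun h => by
    have := integral_map (μ := μ) (φ := fun y => ⟪y, h⟫) (f := id) (by fun_prop) (by fun_prop)
    rw [hmap h] at this
    simpa using this.symm
  have hmem : ∀ h, MemLp (fun y => ⟪y, h⟫) 2 μ := fun h => by
    have : MemLp id 2 (μ.map (fun y => ⟪y, h⟫)) := by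
      rw [hmap h]; exact IsGaussian.memLp_two_id
    exact (memLp_map_measure_iff (by fun_prop) (by fun_prop)).1 this
  have hsq : ∀ h, ∫ y, ⟪y, h⟫ ^ 2 ∂μ = ⟪T h, h⟫ := fun h => by
    have h0 := variance_of_integral_eq_zero (by fun_prop) (hint h)
    have := variance_map (μ := μ) (X := id) (Y := fun y => ⟪y, h⟫) (by fun_prop) (by fun_prop)
    rw [hmap h, variance_id_gaussianReal, Real.coe_toNNReal _ (hT.inner_nonneg_left h)] at this
    rw [← h0, this]; rfl
  refine ⟨isGaussian_of_map_eq_gaussianReal fun L => ?_, hint, fun h k => ?_⟩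
  · refine ⟨0, _, Eq.trans ?_ (hmap ((InnerProductSpace.toDual ℝ H).symm L))⟩
    congr 1; ext y
    rw [real_inner_comm, InnerProductSpace.toDual_symm_apply]
  · have e1 : ∀ y, ⟪y, h⟫ * ⟪y, k⟫ = (⟪y, h + k⟫ ^ 2 - ⟪y, h⟫ ^ 2 - ⟪y, k⟫ ^ 2) / 2 := fun y => by
      rw [inner_add_right]; ring
    simp_rw [e1]
    have i1 := (hmem (h + k)).integrable_sq.sub (hmem h).integrable_sq
    simp only [Pi.sub_def] at i1
    rw [integral_div, integral_sub i1 (hmem _).integrable_sq, integral_sub (hmem _).integrable_sq (hmem _).integrable_sq,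
      hsq, hsq, hsq]
    have : ⟪T k, h⟫ = ⟪T h, k⟫ := by
      have := hT.inner_left_eq_inner_right k h
      rw [this, real_inner_comm]
    simp only [map_add, inner_add_left, inner_add_right, this]
    ring

/-- A series `∑ ξ_i v_i` with independent standard Gaussian coefficients and
`∑ ‖v i‖ ^ 2 < ∞` has a limit in law, with characteristic function
`exp (-∑ ⟨v i, h⟩ ^ 2 / 2)`. -/
theorem exists_measure_charFun_eq [SecondCountableTopology H] {ι : Type u} (v : ι → H)
    (hv : Summable fun i => ‖v i‖ ^ 2) (q : H → ℝ)
    (hq : ∀ h, HasSum (fun i => ⟪v i, h⟫ ^ 2) (q h)) :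
    ∃ μ : Measure H, IsProbabilityMeasure μ ∧
      ∀ h, charFun μ h = Complex.exp (-(q h : ℝ) / 2) := by
  classical
  -- The coordinates of this product space serve as the independent standard Gaussian coefficients.
  set P : Measure (ι → ℝ) := Measure.infinitePi fun _ => gaussianReal 0 1 with hP
  have hlaw : ∀ i, MeasurePreserving (fun ω : ι → ℝ => ω i) P (gaussianReal 0 1) := fun i =>
    measurePreserving_eval_infinitePi _ i
  have hξ : ∀ i, MemLp (fun ω : ι → ℝ => ω i) 2 P := fun i =>
    (IsGaussian.memLp_two_id (μ := gaussianReal 0 1)).comp_measurePreserving (hlaw i)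
  have hmean : ∀ i, ∫ ω, ω i ∂P = 0 := fun i => by
    have := integral_map (μ := P) (φ := fun ω : ι → ℝ => ω i) (f := id)
      (hlaw i).measurable.aemeasurable (by fun_prop)
    rw [(hlaw i).map_eq] at this
    simpa using this.symm
  have hvar : ∀ i, ∫ ω, ω i ^ 2 ∂P = 1 := fun i => by
    have := integral_map (μ := P) (φ := fun ω : ι → ℝ => ω i) (f := fun x => x ^ 2)
      (hlaw i).measurable.aemeasurable (by fun_prop)
    rw [(hlaw i).map_eq] at this
    rw [← this, ← variance_of_integral_eq_zero (X := fun x => x) (by fun_prop) (by simp)]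
    exact variance_id_gaussianReal
  have hX : ∀ i, MemLp (fun ω : ι → ℝ => ω i • v i) 2 P := fun i =>
    (ContinuousLinearMap.toSpanSingleton ℝ (v i)).comp_memLp' (hξ i)
  have hcross : ∀ i j, i ≠ j → ∫ ω, ω i * ω j ∂P = 0 := fun i j hij => by
    have hind : iIndepFun (fun i (ω : ι → ℝ) => ω i) P :=
      iIndepFun_infinitePi (X := fun _ x => x) (fun _ => measurable_id)
    rw [(hind.indepFun hij).integral_fun_mul_eq_mul_integral (hξ i).1 (hξ j).1, hmean, zero_mul]
  let X : ι → Lp H 2 P := fun i => (hX i).toLp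
  have hXorth : ∀ i j, i ≠ j → ⟪X i, X j⟫ = 0 := fun i j hij => by
    rw [L2.inner_def]
    have : ∀ᵐ ω ∂P, ⟪X i ω, X j ω⟫ = ⟪v i, v j⟫ * (ω i * ω j) := by
      filter_upwards [(hX i).coeFn_toLp, (hX j).coeFn_toLp] with ω h1 h2
      rw [h1, h2, real_inner_smul_left, real_inner_smul_right]; ring
    rw [integral_congr_ae this, integral_const_mul, hcross i j hij, mul_zero]
  have hXnorm : ∀ i, ‖X i‖ ^ 2 = ‖v i‖ ^ 2 := fun i => by
    have : ∀ᵐ ω ∂P, ⟪X i ω, X i ω⟫ = ‖v i‖ ^ 2 * ω i ^ 2 := by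
      filter_upwards [(hX i).coeFn_toLp] with ω h1
      rw [h1, real_inner_smul_left, real_inner_smul_right, real_inner_self_eq_norm_sq]; ring
    rw [← real_inner_self_eq_norm_sq, L2.inner_def, integral_congr_ae this, integral_const_mul,
      hvar, mul_one]
  -- The terms are orthogonal in L², so square summability of their norms gives unconditional
  -- convergence; almost sure convergence is not needed.
  have hsum : Summable X := by
    have hO : OrthogonalFamily ℝ (fun i => (ℝ ∙ X i)) fun i => (ℝ ∙ X i).subtypeₗᵢ := by
      refine OrthogonalFamily.of_pairwise fun i j hij => ?_
      rw [Function.onFun, Submodule.isOrtho_span]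
      rintro _ rfl _ rfl
      exact hXorth i j hij
    refine (hO.summable_iff_norm_sq_summable
      fun i => ⟨X i, Submodule.mem_span_singleton_self _⟩).2 ?_
    simpa [hXnorm] using hv
  have hcoe : ∀ s : Finset ι, ⇑(∑ i ∈ s, X i) =ᵐ[P] fun ω => ∑ i ∈ s, ω i • v i := fun s => by
    induction s using Finset.induction_on with
    | empty => simp only [Finset.sum_empty]; exact Lp.coeFn_zero H 2 P
    | insert a s ha ih =>
      rw [Finset.sum_insert ha]
      filter_upwards [Lp.coeFn_add (X a) (∑ i ∈ s, X i), ih, (hX a).coeFn_toLp] with ω h1 h2 h3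
      rw [h1, Pi.add_apply, h2, h3, Finset.sum_insert ha]
  have hchar : ∀ (s : Finset ι) (h : H),
      ∫ ω, Complex.exp ((⟪(∑ i ∈ s, X i : Lp H 2 P) ω, h⟫ : ℝ) * Complex.I) ∂P =
        Complex.exp (-(∑ i ∈ s, ⟪v i, h⟫ ^ 2 : ℝ) / 2) := fun s h => by
    have h1 : ∀ᵐ ω ∂P, Complex.exp ((⟪(∑ i ∈ s, X i : Lp H 2 P) ω, h⟫ : ℝ) * Complex.I) =
        (fun y : s → ℝ => ∏ i : s, Complex.exp (⟪v i, h⟫ * y i * Complex.I)) (s.restrict ω) := by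
      filter_upwards [hcoe s] with ω hω
      have h2 := Finset.sum_coe_sort s (fun i => ((⟪v i, h⟫ : ℝ) : ℂ) * (ω i : ℂ))
      rw [hω, sum_inner, ← Complex.exp_sum, ← Finset.sum_mul]
      refine congrArg Complex.exp (congrArg (· * Complex.I) (Eq.trans ?_ h2.symm))
      push_cast
      exact Finset.sum_congr rfl fun i _ => by rw [real_inner_smul_left]; push_cast; ring
    have h3 := integral_restrict_infinitePi (μ := fun _ : ι => gaussianReal 0 1) (s := s)
      (f := fun y : s → ℝ => ∏ i : s, Complex.exp (⟪v i, h⟫ * y i * Complex.I))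
      (Measurable.aestronglyMeasurable (by fun_prop))
    rw [integral_congr_ae h1, h3, integral_fintype_prod_eq_prod (𝕜 := ℂ)
        (f := fun (i : s) (x : ℝ) => Complex.exp (⟪v i, h⟫ * x * Complex.I))]
    simp_rw [← charFun_apply_real, charFun_gaussianReal]
    rw [← Complex.exp_sum, Finset.sum_coe_sort s (fun i => ((⟪v i, h⟫ : ℝ) : ℂ) *
      ((0 : ℝ) : ℂ) * Complex.I - ((1 : NNReal) : ℂ) * ((⟪v i, h⟫ : ℝ) : ℂ) ^ 2 / 2)]
    congr 1
    push_cast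
    rw [neg_div, Finset.sum_div, ← Finset.sum_neg_distrib]
    exact Finset.sum_congr rfl fun i _ => by simp
  have hL1 : ∀ u : Lp H 2 P, ∫ ω, ‖u ω‖ ∂P ≤ ‖u‖ := fun u => by
    rw [integral_norm_eq_lintegral_enorm (Lp.aestronglyMeasurable u),
      ← eLpNorm_one_eq_lintegral_enorm, Lp.norm_def]
    exact ENNReal.toReal_mono (Lp.eLpNorm_ne_top u) (eLpNorm_le_eLpNorm_of_exponent_le
      (by norm_num) (Lp.aestronglyMeasurable u))
  -- The map u ↦ e^{iu} is 1-Lipschitz, so L² convergence of the partial sums, which implies L¹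
  -- convergence on a probability space, carries over to characteristic functions.
  have hexp : ∀ a b : ℝ, ‖Complex.exp (a * Complex.I) - Complex.exp (b * Complex.I)‖ ≤ |a - b| := by
    intro a b
    have : Complex.exp (a * Complex.I) - Complex.exp (b * Complex.I) =
        Complex.exp (b * Complex.I) * (Complex.exp (Complex.I * (a - b : ℝ)) - 1) := by
      rw [mul_sub, ← Complex.exp_add]; congr 2
      · push_cast; ring
      · ring
    rw [this, norm_mul, Complex.norm_exp_ofReal_mul_I, one_mul]
    exact Real.norm_exp_I_mul_ofReal_sub_one_le
  set Z : Lp H 2 P := ∑' i, X i with hZ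
  have hZm : AEMeasurable Z P := (Lp.aestronglyMeasurable Z).aemeasurable
  refine ⟨P.map Z, Measure.isProbabilityMeasure_map hZm, fun h => ?_⟩
  rw [charFun_apply, integral_map hZm (by fun_prop)]
  have hint : ∀ u : Lp H 2 P, Integrable (fun ω => Complex.exp ((⟪u ω, h⟫ : ℝ) * Complex.I)) P :=
    fun u => by
      refine Integrable.of_bound (C := 1) ?_ (ae_of_all _ fun ω => ?_)
      · have hc : Continuous fun y : H => Complex.exp ((⟪y, h⟫ : ℝ) * Complex.I) := by fun_prop
        exact hc.comp_aestronglyMeasurable (Lp.aestronglyMeasurable u)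
      · rw [Complex.norm_exp_ofReal_mul_I]
  have hlim : Tendsto (fun s : Finset ι =>
      ∫ ω, Complex.exp ((⟪(∑ i ∈ s, X i : Lp H 2 P) ω, h⟫ : ℝ) * Complex.I) ∂P) atTop
      (𝓝 (∫ ω, Complex.exp ((⟪Z ω, h⟫ : ℝ) * Complex.I) ∂P)) := by
    have h0 : Tendsto (fun s : Finset ι => ‖h‖ * ‖(∑ i ∈ s, X i) - Z‖) atTop (𝓝 0) := by
      have := (tendsto_iff_norm_sub_tendsto_zero.1 hsum.hasSum).const_mul ‖h‖
      simpa using this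
    refine tendsto_iff_norm_sub_tendsto_zero.2
      (squeeze_zero (fun _ => norm_nonneg _) (fun s => ?_) h0)
    rw [← integral_sub (hint _) (hint _)]
    refine (norm_integral_le_integral_norm _).trans ?_
    refine le_trans ?_ (mul_le_mul_of_nonneg_left (hL1 _) (norm_nonneg h))
    rw [← integral_const_mul]
    refine integral_mono_ae ((hint _).sub (hint _)).norm
      (((Lp.memLp _).integrable (by norm_num)).norm.const_mul _) ?_
    filter_upwards [Lp.coeFn_sub (∑ i ∈ s, X i) Z] with ω hω
    refine (hexp _ _).trans ?_
    rw [hω, Pi.sub_apply, ← inner_sub_left, mul_comm]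
    exact abs_real_inner_le_norm _ _
  refine tendsto_nhds_unique hlim ?_
  simp_rw [hchar]
  refine (Complex.continuous_exp.tendsto _).comp (Tendsto.div_const (Tendsto.neg ?_) _)
  exact (Complex.continuous_ofReal.tendsto _).comp (hq h)

/-- Existence of the Gaussian measure with a given positive trace class covariance operator. -/
theorem exists_isCenteredGaussian [SecondCountableTopology H] (T : H →L[ℝ] H)
    (hT : T.IsPositive) (hTc : IsTraceClass T) : ∃ μ : Measure H, IsCenteredGaussian T μ := by
  obtain ⟨ι, v, hv, hq⟩ := exists_hasSum_sq_inner T hT hTc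
  obtain ⟨μ, _, hμ⟩ := exists_measure_charFun_eq v hv _ hq
  exact ⟨μ, isCenteredGaussian_of_charFun T hT μ hμ⟩

end GaussianExistence

/-- Averages over shrinking intervals converge at points of right continuity. -/
theorem tendsto_average_of_continuousOn {E : Type*} [NormedAddCommGroup E] [NormedSpace ℝ E]
    [CompleteSpace E] {f : ℝ → E} (hf : ContinuousOn f (Set.Ici 0)) {s : ℝ} (hs : 0 ≤ s) :
    Tendsto (fun t : ℝ => t⁻¹ • ∫ r in s..(s + t), f r) (𝓝[>] 0) (𝓝 (f s)) := by
  have h1 : HasDerivWithinAt (fun u => ∫ r in s..u, f r) (f s) (Set.Ioi s) s := by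
    refine (intervalIntegral.integral_hasDerivWithinAt_right (by simp)
      (s := Set.Ici s) (t := Set.Ioi s) ⟨Set.Ioi s, self_mem_nhdsWithin, ?_⟩ ?_).mono
      Set.Ioi_subset_Ici_self
    · exact ((hf).mono fun y hy =>
        hs.trans (le_of_lt hy)).aestronglyMeasurable measurableSet_Ioi
    · exact ((hf) s hs).mono fun y hy => hs.trans (le_of_lt hy)
  rw [hasDerivWithinAt_iff_tendsto_slope' (by simp)] at h1
  have h2 : Tendsto (fun t : ℝ => s + t) (𝓝[>] 0) (𝓝[>] s) := by
    refine tendsto_nhdsWithin_iff.2 ⟨?_, ?_⟩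
    · have : Tendsto (fun t : ℝ => s + t) (𝓝 0) (𝓝 (s + 0)) := by
        exact (continuous_const.add continuous_id).tendsto 0
      rw [add_zero] at this
      exact this.mono_left nhdsWithin_le_nhds
    · filter_upwards [self_mem_nhdsWithin] with t ht using by simpa using ht
  refine (h1.comp h2).congr fun t => ?_
  simp [slope_def_module]

/-! ### Strongly continuous semigroups and their generators. -/

namespace C0Semigroup

variable {H : Type u} [NormedAddCommGroup H] [InnerProductSpace ℝ H]

section Basic

variable (S : C0Semigroup H)

theorem op_add_apply {s t : ℝ} (hs : 0 ≤ s) (ht : 0 ≤ t) (x : H) :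
    S.op (s + t) x = S.op s (S.op t x) := by
  rw [S.op_add s t hs ht]; rfl

theorem generator_apply_eq {x y : H}
    (h : Tendsto (fun t : ℝ => t⁻¹ • (S.op t x - x)) (𝓝[>] 0) (𝓝 y)) (hx : x ∈ S.domain) :
    S.generator ⟨x, hx⟩ = y :=
  tendsto_nhds_unique (Classical.choose_spec hx) h

theorem tendsto_generator (x : S.domain) :
    Tendsto (fun t : ℝ => t⁻¹ • (S.op t x - x)) (𝓝[>] 0) (𝓝 (S.generator x)) :=
  Classical.choose_spec x.2

theorem op_mem_domain {x y : H} {s : ℝ} (hs : 0 ≤ s)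
    (h : Tendsto (fun t : ℝ => t⁻¹ • (S.op t x - x)) (𝓝[>] 0) (𝓝 y)) :
    Tendsto (fun t : ℝ => t⁻¹ • (S.op t (S.op s x) - S.op s x)) (𝓝[>] 0) (𝓝 (S.op s y)) := by
  refine (((S.op s).continuous.tendsto y).comp h).congr' ?_
  filter_upwards [self_mem_nhdsWithin] with t ht
  have ht' : (0 : ℝ) ≤ t := le_of_lt ht
  rw [Function.comp_apply, map_smul, map_sub, ← S.op_add_apply hs ht', ← S.op_add_apply ht' hs,
    add_comm]

theorem continuousOn_Icc (x : H) (a b : ℝ) (ha : 0 ≤ a) :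
    ContinuousOn (fun t => S.op t x) (Set.Icc a b) :=
  (S.continuousOn_op x).mono fun _ ht => ha.trans ht.1

theorem intervalIntegrable_op (x : H) {a b : ℝ} (ha : 0 ≤ a) (hb : 0 ≤ b) :
    IntervalIntegrable (fun t => S.op t x) volume a b :=
  ContinuousOn.intervalIntegrable ((S.continuousOn_op x).mono fun _ ht =>
    (le_min ha hb).trans ht.1)

variable [CompleteSpace H]

/-- Orbits are continuous, hence bounded, on the compact interval; Banach–Steinhaus makes the bound
uniform. -/
theorem exists_norm_op_le (a : ℝ) : ∃ M : ℝ, 0 ≤ M ∧ ∀ t ∈ Set.Icc 0 a, ‖S.op t‖ ≤ M := by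
  obtain ⟨C, hC⟩ := banach_steinhaus (g := fun t : Set.Icc (0 : ℝ) a => S.op t) fun x => by
    obtain ⟨C, hC⟩ := isCompact_Icc.exists_bound_of_continuousOn (S.continuousOn_Icc x 0 a le_rfl)
    exact ⟨C, fun t => hC t t.2⟩
  exact ⟨max C 0, le_max_right _ _, fun t ht => (hC ⟨t, ht⟩).trans (le_max_left _ _)⟩

/-- `(1 / t) ∫_s^{s+t} e^{rA} x dr → e^{sA} x`. -/
theorem tendsto_average (x : H) {s : ℝ} (hs : 0 ≤ s) :
    Tendsto (fun t : ℝ => t⁻¹ • ∫ r in s..(s + t), S.op r x) (𝓝[>] 0) (𝓝 (S.op s x)) :=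
  tendsto_average_of_continuousOn (S.continuousOn_op x) hs

/-- The difference telescopes to ∫_a^{a+t} - ∫_0^t, and averages over shrinking intervals converge
by right continuity. -/
theorem tendsto_integral (x : H) {a : ℝ} (ha : 0 ≤ a) :
    Tendsto (fun t : ℝ => t⁻¹ • (S.op t (∫ s in (0 : ℝ)..a, S.op s x) -
      ∫ s in (0 : ℝ)..a, S.op s x)) (𝓝[>] 0) (𝓝 (S.op a x - x)) := by
  have h := (S.tendsto_average x ha).sub (S.tendsto_average x le_rfl)
  rw [S.op_zero] at h
  refine h.congr' ?_
  filter_upwards [self_mem_nhdsWithin] with t ht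
  have ht' : (0 : ℝ) ≤ t := le_of_lt ht
  have e1 : S.op t (∫ s in (0 : ℝ)..a, S.op s x) = ∫ s in t..(a + t), S.op s x := by
    rw [← ContinuousLinearMap.intervalIntegral_comp_comm _ (S.intervalIntegrable_op x le_rfl ha)]
    have : ∀ s ∈ Set.uIcc 0 a, S.op t (S.op s x) = (fun r => S.op r x) (s + t) := fun s hs => by
      rw [Set.uIcc_of_le ha] at hs
      rw [← S.op_add_apply ht' hs.1, add_comm]
    rw [intervalIntegral.integral_congr this,
      intervalIntegral.integral_comp_add_right (fun r => S.op r x), zero_add]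
  rw [e1, ← smul_sub, zero_add]
  congr 1
  have i1 := S.intervalIntegrable_op x le_rfl ha
  have i2 := S.intervalIntegrable_op x le_rfl ht'
  have i3 := S.intervalIntegrable_op x ha (add_nonneg ha ht')
  have i4 := S.intervalIntegrable_op x ht' (add_nonneg ha ht')
  have e2 := intervalIntegral.integral_add_adjacent_intervals i1 i3
  have e3 := intervalIntegral.integral_add_adjacent_intervals i2 i4
  rw [sub_eq_sub_iff_add_eq_add, add_comm (∫ s in a..(a + t), S.op s x), add_comm (∫ s in t..(a + t), S.op s x), e2, e3]

theorem integral_mem_domain (x : H) {a : ℝ} (ha : 0 ≤ a) :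
    ∫ s in (0 : ℝ)..a, S.op s x ∈ S.domain :=
  ⟨_, S.tendsto_integral x ha⟩

/-- The averages t⁻¹∫_0^t e^{sA}x ds lie in D(A) and tend to x. -/
theorem dense_domain : Dense (S.domain : Set H) := fun x => by
  have h := S.tendsto_average x le_rfl
  rw [S.op_zero] at h
  refine mem_closure_of_tendsto h ?_
  filter_upwards [self_mem_nhdsWithin] with t ht
  exact S.domain.smul_mem _ (by simpa using S.integral_mem_domain x (le_of_lt ht))

/-- `e^{tA} x - x = ∫_0^t e^{sA} A x ds` for `x ∈ D(A)`. -/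
theorem op_sub_self_eq_integral (x : S.domain) {a : ℝ} (ha : 0 ≤ a) :
    S.op a x - x = ∫ s in (0 : ℝ)..a, S.op s (S.generator x) := by
  have h := intervalIntegral.integral_eq_sub_of_hasDeriv_right (a := 0) (b := a)
    (f := fun s => S.op s x) (f' := fun s => S.op s (S.generator x)) ?_ ?_
    (S.intervalIntegrable_op _ le_rfl ha)
  · rw [h, S.op_zero]; rfl
  · exact (S.continuousOn_op _).mono fun y hy => by
      rw [Set.uIcc_of_le ha] at hy; exact hy.1
  · intro s hs
    rw [min_eq_left ha] at hs
    rw [hasDerivWithinAt_iff_tendsto_slope' (by simp)]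
    have h2 : Tendsto (fun t : ℝ => t - s) (𝓝[>] s) (𝓝[>] 0) := by
      refine tendsto_nhdsWithin_iff.2 ⟨?_, ?_⟩
      · have : Tendsto (fun t : ℝ => t - s) (𝓝 s) (𝓝 (s - s)) :=
          (continuous_id.sub continuous_const).tendsto s
        rw [sub_self] at this
        exact this.mono_left nhdsWithin_le_nhds
      · filter_upwards [self_mem_nhdsWithin] with t ht using by simpa using ht
    refine ((S.op_mem_domain hs.1.le (S.tendsto_generator x)).comp h2).congr' ?_
    filter_upwards [self_mem_nhdsWithin] with t ht
    have ht' : s < t := ht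
    rw [Function.comp_apply, ← S.op_add_apply (by linarith) hs.1.le, sub_add_cancel,
      slope_def_module]

end Basic

/-! ### The adjoint generator and the adjoint semigroup. -/

section Adjoint

variable [CompleteSpace H] (S : C0Semigroup H)

/-- The domain `D(A*)` of the adjoint of the generator. -/
def adjDom : Submodule ℝ H := S.generator.adjoint.domain

variable {S} in
theorem mem_adjDom {h : H} (w : H) (hw : ∀ x : S.domain, ⟪w, x⟫ = ⟪h, S.generator x⟫) :
    h ∈ S.adjDom :=
  LinearPMap.mem_adjoint_domain_of_exists _ ⟨w, hw⟩

variable {S} in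
theorem adjoint_apply_eq {h : H} (hh : h ∈ S.generator.adjoint.domain) {w : H}
    (hw : ∀ x : S.domain, ⟪w, x⟫ = ⟪h, S.generator x⟫) : S.generator.adjoint ⟨h, hh⟩ = w :=
  LinearPMap.adjoint_apply_eq (T := S.generator) S.dense_domain ⟨h, hh⟩ hw

theorem inner_adjoint (h : S.adjDom) (x : S.domain) :
    ⟪S.generator.adjoint h, x⟫ = ⟪(h : H), S.generator x⟫ :=
  LinearPMap.adjoint_isFormalAdjoint (T := S.generator) S.dense_domain h x

theorem inner_adjoint_of_tendsto (h : S.adjDom) {x y : H}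
    (hx : Tendsto (fun t : ℝ => t⁻¹ • (S.op t x - x)) (𝓝[>] 0) (𝓝 y)) :
    ⟪S.generator.adjoint h, x⟫ = ⟪(h : H), y⟫ :=
  (S.inner_adjoint h ⟨x, y, hx⟩).trans
    (congrArg (fun z => ⟪(h : H), z⟫) (S.generator_apply_eq hx ⟨y, hx⟩))

/-- `⟨e^{tA} x - x, h⟩ = ∫_0^t ⟨e^{sA} x, A* h⟩ ds` for `h ∈ D(A*)` and every `x`. -/
theorem inner_op_sub_self (h : S.adjDom) (x : H) {a : ℝ} (ha : 0 ≤ a) :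
    ⟪S.op a x - x, h⟫ = ∫ s in (0 : ℝ)..a, ⟪S.op s x, S.generator.adjoint h⟫ := by
  have h1 := S.inner_adjoint_of_tendsto h (S.tendsto_integral x ha)
  rw [real_inner_comm, ← h1]
  exact ((innerSL ℝ (S.generator.adjoint h)).intervalIntegral_comp_comm
    (S.intervalIntegrable_op x le_rfl ha)).symm.trans
    (intervalIntegral.integral_congr fun s _ => real_inner_comm _ _)

/-- The integrated semigroup `x ↦ ∫_0^a e^{sA} x ds` as a bounded operator. -/
theorem exists_integral_clm {a : ℝ} (ha : 0 ≤ a) :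
    ∃ J : H →L[ℝ] H, ∀ x, J x = ∫ s in (0 : ℝ)..a, S.op s x := by
  obtain ⟨M, hM0, hM⟩ := S.exists_norm_op_le a
  refine ⟨LinearMap.mkContinuous
    { toFun := fun x => ∫ s in (0 : ℝ)..a, S.op s x
      map_add' := fun x y => by
        simp only [map_add]
        exact intervalIntegral.integral_add (S.intervalIntegrable_op x le_rfl ha)
          (S.intervalIntegrable_op y le_rfl ha)
      map_smul' := fun c x => by
        simp only [map_smul, RingHom.id_apply]
        exact intervalIntegral.integral_smul _ _ } (M * a) fun x => ?_, fun x => rfl⟩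
  have := intervalIntegral.norm_integral_le_of_norm_le_const (a := 0) (b := a) (C := M * ‖x‖)
    (f := fun s => S.op s x) fun s hs => by
      rw [Set.uIoc_of_le ha] at hs
      exact (S.op s).le_of_opNorm_le (hM s ⟨hs.1.le, hs.2⟩) x
  rw [sub_zero, abs_of_nonneg ha] at this
  calc _ ≤ M * ‖x‖ * a := this
    _ = _ := by ring

/-- Let J be the integrated semigroup up to time a. For every h, J†h lies in D(A*), because A*J†h =
e^{aA*}h - h. A vector k orthogonal to D(A*) therefore satisfies Jk = 0 for every a, and dividing by
a and letting a → 0 gives k = 0. -/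
theorem dense_adjDom : Dense (S.adjDom : Set H) := by
  rw [Submodule.dense_iff_topologicalClosure_eq_top, Submodule.topologicalClosure_eq_top_iff,
    Submodule.eq_bot_iff]
  intro k hk
  have h0 : ∀ a : ℝ, 0 ≤ a → ∫ s in (0 : ℝ)..a, S.op s k = 0 := fun a ha => by
    obtain ⟨J, hJ⟩ := S.exists_integral_clm ha
    rw [← hJ]
    refine ext_inner_left ℝ fun h => ?_
    rw [inner_zero_right, ← ContinuousLinearMap.adjoint_inner_left]
    refine (Submodule.mem_orthogonal _ _).1 hk _ (mem_adjDom
      (ContinuousLinearMap.adjoint (S.op a) h - h) fun x => ?_)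
    rw [ContinuousLinearMap.adjoint_inner_left, hJ, ← S.op_sub_self_eq_integral x ha,
      inner_sub_left, inner_sub_right, ContinuousLinearMap.adjoint_inner_left]
  have h1 := S.tendsto_average k le_rfl
  rw [S.op_zero] at h1
  refine tendsto_nhds_unique (h1.congr' ?_) tendsto_const_nhds
  filter_upwards [self_mem_nhdsWithin] with t ht
  rw [zero_add, h0 t (le_of_lt ht), smul_zero]

/-- The adjoint semigroup `e^{tA*}`. -/
def adj (t : ℝ) : H →L[ℝ] H := ContinuousLinearMap.adjoint (S.op t)

theorem inner_adj_left (t : ℝ) (h x : H) : ⟪S.adj t h, x⟫ = ⟪h, S.op t x⟫ :=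
  ContinuousLinearMap.adjoint_inner_left _ _ _

theorem inner_adj_right (t : ℝ) (h x : H) : ⟪x, S.adj t h⟫ = ⟪S.op t x, h⟫ :=
  ContinuousLinearMap.adjoint_inner_right _ _ _

theorem norm_adj (t : ℝ) : ‖S.adj t‖ = ‖S.op t‖ :=
  LinearIsometryEquiv.norm_map ContinuousLinearMap.adjoint (S.op t)

theorem adj_zero (h : H) : S.adj 0 h = h := by
  refine ext_inner_right ℝ fun x => ?_
  rw [inner_adj_left, S.op_zero]; rfl

theorem adj_add_apply {s t : ℝ} (hs : 0 ≤ s) (ht : 0 ≤ t) (h : H) :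
    S.adj (s + t) h = S.adj t (S.adj s h) := by
  refine ext_inner_right ℝ fun x => ?_
  rw [inner_adj_left, inner_adj_left, inner_adj_left, S.op_add_apply hs ht]

theorem inner_adj_adjoint (h : S.adjDom) {s : ℝ} (hs : 0 ≤ s) (x : S.domain) :
    ⟪S.adj s (S.generator.adjoint h), x⟫ = ⟪S.adj s h, S.generator x⟫ := by
  rw [inner_adj_left, inner_adj_left,
    S.inner_adjoint_of_tendsto h (S.op_mem_domain hs (S.tendsto_generator x))]

/-- For h ∈ D(A*) the weak identity `inner_op_sub_self` writes the increment as an integral of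
⟨e^{rA}x, A*h⟩, so the adjoint orbit is locally Lipschitz. -/
theorem norm_adj_sub_le (h : S.adjDom) {a M : ℝ} (hM : ∀ t ∈ Set.Icc 0 a, ‖S.op t‖ ≤ M)
    {s t : ℝ} (hs : s ∈ Set.Icc 0 a) (ht : t ∈ Set.Icc 0 a) :
    ‖S.adj t h - S.adj s h‖ ≤ M * ‖S.generator.adjoint h‖ * |t - s| := by
  have hM0 : 0 ≤ M := (norm_nonneg _).trans (hM s hs)
  have key : ∀ x, ⟪S.adj t h - S.adj s h, x⟫ ≤ M * ‖S.generator.adjoint h‖ * |t - s| * ‖x‖ := by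
    intro x
    have i1 : ∀ r : ℝ, 0 ≤ r → IntervalIntegrable
        (fun r => ⟪S.op r x, S.generator.adjoint h⟫) volume 0 r := fun r hr =>
      ContinuousOn.intervalIntegrable (((S.continuousOn_op x).inner continuousOn_const).mono
        fun y hy => by rw [Set.uIcc_of_le hr] at hy; exact hy.1)
    have e : ⟪S.adj t h - S.adj s h, x⟫ =
        ∫ r in s..t, ⟪S.op r x, S.generator.adjoint h⟫ := by
      rw [← intervalIntegral.integral_interval_sub_left (i1 t ht.1) (i1 s hs.1),
        ← S.inner_op_sub_self h x ht.1, ← S.inner_op_sub_self h x hs.1, inner_sub_left,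
        inner_adj_left, inner_adj_left, inner_sub_left, inner_sub_left,
        real_inner_comm _ (h : H), real_inner_comm _ (h : H)]
      ring
    rw [e]
    suffices hb : ‖∫ r in s..t, ⟪S.op r x, S.generator.adjoint h⟫‖ ≤
        M * ‖x‖ * ‖S.generator.adjoint h‖ * |t - s| from
      (le_abs_self _).trans (hb.trans_eq (by ring))
    refine intervalIntegral.norm_integral_le_of_norm_le_const fun r hr => ?_
    refine (norm_inner_le_norm _ _).trans ?_
    have hr' : r ∈ Set.Icc 0 a :=
      ⟨(le_min hs.1 ht.1).trans hr.1.le, hr.2.trans (max_le hs.2 ht.2)⟩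
    gcongr
    exact (S.op r).le_of_opNorm_le (hM r hr') x
  -- Testing against the difference itself bounds its squared norm; one factor then cancels unless
  -- it vanishes.
  have := key (S.adj t h - S.adj s h)
  rw [real_inner_self_eq_norm_mul_norm] at this
  rcases (norm_nonneg (S.adj t h - S.adj s h)).eq_or_lt with h0 | h0
  · rw [← h0]; positivity
  · exact le_of_mul_le_mul_right this h0

/-- Orbits starting in the dense set D(A*) are Lipschitz on bounded intervals, and the local bound
on ‖e^{tA*}‖ makes the other orbits uniform limits of these. -/
theorem continuousOn_adj (h : H) : ContinuousOn (fun t => S.adj t h) (Set.Ici 0) := by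
  have key : ∀ a : ℝ, ContinuousOn (fun t => S.adj t h) (Set.Icc 0 a) := fun a => by
    obtain ⟨M, hM0, hM⟩ := S.exists_norm_op_le a
    refine continuousOn_of_uniform_approx_of_continuousOn fun u hu => ?_
    obtain ⟨ε, hε, hu⟩ := Metric.mem_uniformity_dist.1 hu
    obtain ⟨k, hk, hkd⟩ := Metric.dense_iff.1 S.dense_adjDom h (ε / (M + 1)) (by positivity)
    refine ⟨fun t => S.adj t k, ?_, fun t ht => hu ?_⟩
    · refine LipschitzOnWith.continuousOn (K := (M * ‖S.generator.adjoint ⟨k, hkd⟩‖).toNNReal)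
        (LipschitzOnWith.of_dist_le_mul fun t ht s hs => ?_)
      rw [Real.coe_toNNReal _ (by positivity), dist_eq_norm, Real.dist_eq]
      exact S.norm_adj_sub_le ⟨k, hkd⟩ hM hs ht
    · rw [dist_eq_norm, ← map_sub]
      rw [Metric.mem_ball, dist_comm, dist_eq_norm, lt_div_iff₀ (by positivity)] at hk
      have h1 := (S.adj t).le_of_opNorm_le ((S.norm_adj t).trans_le (hM t ht)) (h - k)
      nlinarith [norm_nonneg (h - k)]
  intro t ht
  exact (key (t + 1) t ⟨ht, by linarith⟩).mono_of_mem_nhdsWithin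
    (inter_mem_nhdsWithin _ (Iic_mem_nhds (by linarith)))

end Adjoint

end C0Semigroup

/-! ### The covariance operators Q_t and their quadratic forms. -/

section Covariance

variable {H : Type u} [NormedAddCommGroup H] [InnerProductSpace ℝ H] [CompleteSpace H]
  (S : C0Semigroup H) (Q : H →L[ℝ] H)

/-- Strong continuity together with local uniform boundedness allows operator and argument to vary
simultaneously. -/
theorem C0Semigroup.continuousOn_op_comp {y : ℝ → H} (hy : ContinuousOn y (Set.Ici 0)) :
    ContinuousOn (fun s => S.op s (y s)) (Set.Ici 0) := by
  intro t ht
  obtain ⟨M, hM0, hM⟩ := S.exists_norm_op_le (t + 1)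
  have h1 : Tendsto (fun s => M * ‖y s - y t‖ + ‖S.op s (y t) - S.op t (y t)‖)
      (𝓝[Set.Ici 0] t) (𝓝 0) := by
    have := ((tendsto_iff_norm_sub_tendsto_zero.1 (hy t ht)).const_mul M).add
      (tendsto_iff_norm_sub_tendsto_zero.1 (S.continuousOn_op (y t) t ht))
    simpa using this
  refine tendsto_iff_norm_sub_tendsto_zero.2 (squeeze_zero' (by simp) ?_ h1)
  filter_upwards [inter_mem_nhdsWithin (Set.Ici (0 : ℝ)) (Iic_mem_nhds (lt_add_one t))] with s hs
  calc ‖S.op s (y s) - S.op t (y t)‖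
      = ‖S.op s (y s - y t) + (S.op s (y t) - S.op t (y t))‖ := by rw [map_sub]; congr 1; abel
    _ ≤ ‖S.op s (y s - y t)‖ + ‖S.op s (y t) - S.op t (y t)‖ := norm_add_le _ _
    _ ≤ _ := by gcongr; exact (S.op s).le_of_opNorm_le (hM s hs) _

theorem continuousOn_covOp_integrand (x : H) :
    ContinuousOn (fun s => S.op s (Q (S.adj s x))) (Set.Ici 0) :=
  S.continuousOn_op_comp (Q.continuous.comp_continuousOn (S.continuousOn_adj x))

theorem continuousOn_inner_adj (x y : H) :
    ContinuousOn (fun s => ⟪Q (S.adj s x), S.adj s y⟫) (Set.Ici 0) :=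
  (Q.continuous.comp_continuousOn (S.continuousOn_adj x)).inner (S.continuousOn_adj y)

theorem intervalIntegrable_of_continuousOn_Ici {E : Type*} [NormedAddCommGroup E] {f : ℝ → E}
    (hf : ContinuousOn f (Set.Ici 0)) {a b : ℝ} (ha : 0 ≤ a) (hb : 0 ≤ b) :
    IntervalIntegrable f volume a b :=
  ContinuousOn.intervalIntegrable (hf.mono fun _ ht => (le_min ha hb).trans ht.1)

theorem inner_covOp {t : ℝ} (ht : 0 ≤ t) (x y : H) :
    ⟪covOp S Q t x, y⟫ = ∫ s in (0 : ℝ)..t, ⟪Q (S.adj s x), S.adj s y⟫ := by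
  rw [real_inner_comm]
  refine ((innerSL ℝ y).intervalIntegral_comp_comm (intervalIntegrable_of_continuousOn_Ici
    (continuousOn_covOp_integrand S Q x) le_rfl ht)).symm.trans
    (intervalIntegral.integral_congr fun s _ => ?_)
  simp only [innerSL_apply_apply]
  rw [real_inner_comm, ← S.inner_adj_right]

variable {Q} in
theorem exists_covOp_clm (hQ : Q.IsPositive) {t : ℝ} (ht : 0 ≤ t) :
    ∃ T : H →L[ℝ] H, ⇑T = covOp S Q t ∧ T.IsPositive := by
  obtain ⟨M, hM0, hM⟩ := S.exists_norm_op_le t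
  have hi := fun x => intervalIntegrable_of_continuousOn_Ici
    (continuousOn_covOp_integrand S Q x) le_rfl ht
  let L : H →ₗ[ℝ] H :=
    { toFun := covOp S Q t
      map_add' := fun x y => by
        simp only [covOp, map_add]
        exact intervalIntegral.integral_add (hi x) (hi y)
      map_smul' := fun c x => by
        simp only [covOp, map_smul, RingHom.id_apply]
        exact intervalIntegral.integral_smul _ _ }
  let T : H →L[ℝ] H := L.mkContinuous (M * (‖Q‖ * M) * t) fun x => by
    have := intervalIntegral.norm_integral_le_of_norm_le_const (a := 0) (b := t)
      (C := M * (‖Q‖ * (M * ‖x‖))) (f := fun s => S.op s (Q (S.adj s x))) fun s hs => by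
        rw [Set.uIoc_of_le ht] at hs
        have hs' : s ∈ Set.Icc 0 t := ⟨hs.1.le, hs.2⟩
        refine (S.op s).le_of_opNorm_le_of_le (hM s hs') (Q.le_opNorm_of_le ?_)
        exact (S.adj s).le_of_opNorm_le ((S.norm_adj s).trans_le (hM s hs')) x
    rw [sub_zero, abs_of_nonneg ht] at this
    calc _ ≤ M * (‖Q‖ * (M * ‖x‖)) * t := this
      _ = _ := by ring
  refine ⟨T, rfl, ?_⟩
  refine (ContinuousLinearMap.isPositive_iff T).2 ⟨fun x y => ?_, fun x => ?_⟩
  · change ⟪covOp S Q t x, y⟫ = ⟪x, covOp S Q t y⟫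
    rw [real_inner_comm (covOp S Q t y) x, inner_covOp S Q ht, inner_covOp S Q ht]
    refine intervalIntegral.integral_congr fun s _ => ?_
    rw [hQ.inner_left_eq_inner_right, real_inner_comm]
  · change 0 ≤ ⟪covOp S Q t x, x⟫
    rw [inner_covOp S Q ht]
    exact intervalIntegral.integral_nonneg ht fun s _ => hQ.inner_nonneg_left _

/-- The quadratic form `⟨Q_t h, h⟩`. -/
def covForm (t : ℝ) (h : H) : ℝ := ⟪covOp S Q t h, h⟫

theorem covForm_eq {t : ℝ} (ht : 0 ≤ t) (h : H) :
    covForm S Q t h = ∫ s in (0 : ℝ)..t, ⟪Q (S.adj s h), S.adj s h⟫ :=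
  inner_covOp S Q ht h h

variable {Q} in
theorem covForm_nonneg (hQ : Q.IsPositive) {t : ℝ} (ht : 0 ≤ t) (h : H) : 0 ≤ covForm S Q t h := by
  rw [covForm_eq S Q ht]
  exact intervalIntegral.integral_nonneg ht fun s _ => hQ.inner_nonneg_left _

theorem covForm_zero (h : H) : covForm S Q 0 h = 0 := by
  rw [covForm_eq S Q le_rfl, intervalIntegral.integral_same]

/-- This is Q_{s+t} = Q_s + e^{sA}Q_t e^{sA*} as quadratic forms: the additivity of exponents behind
the semigroup law on damped cosines. -/
theorem covForm_add {s t : ℝ} (hs : 0 ≤ s) (ht : 0 ≤ t) (h : H) :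
    covForm S Q (s + t) h = covForm S Q s h + covForm S Q t (S.adj s h) := by
  have hi := fun {a b : ℝ} (ha : 0 ≤ a) (hb : 0 ≤ b) => intervalIntegrable_of_continuousOn_Ici
    (continuousOn_inner_adj S Q h h) ha hb
  rw [covForm_eq S Q (add_nonneg hs ht), covForm_eq S Q hs, covForm_eq S Q ht,
    ← intervalIntegral.integral_add_adjacent_intervals (hi le_rfl hs) (hi hs (add_nonneg hs ht))]
  congr 1
  have h1 : ∀ r ∈ Set.uIcc 0 t, ⟪Q (S.adj r (S.adj s h)), S.adj r (S.adj s h)⟫ =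
      (fun r => ⟪Q (S.adj r h), S.adj r h⟫) (s + r) := fun r hr => by
    rw [Set.uIcc_of_le ht] at hr
    simp only [S.adj_add_apply hs hr.1]
  rw [intervalIntegral.integral_congr h1,
    intervalIntegral.integral_comp_add_left (fun r => ⟪Q (S.adj r h), S.adj r h⟫), add_zero]

theorem hasDerivAt_covForm (h : H) {t : ℝ} (ht : 0 < t) :
    HasDerivAt (fun s => covForm S Q s h) ⟪Q (S.adj t h), S.adj t h⟫ t := by
  have hc := continuousOn_inner_adj S Q h h
  have h1 : HasDerivAt (fun u => ∫ s in (0 : ℝ)..u, ⟪Q (S.adj s h), S.adj s h⟫)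
      ⟪Q (S.adj t h), S.adj t h⟫ t := by
    refine intervalIntegral.integral_hasDerivAt_right
      (intervalIntegrable_of_continuousOn_Ici hc le_rfl ht.le)
      ⟨Set.Ici 0, Ici_mem_nhds ht, hc.aestronglyMeasurable measurableSet_Ici⟩
      (hc.continuousAt (Ici_mem_nhds ht))
  refine h1.congr_of_eventuallyEq ?_
  filter_upwards [Ici_mem_nhds ht] with s hs using covForm_eq S Q hs h

theorem continuousOn_covForm (h : H) : ContinuousOn (fun s => covForm S Q s h) (Set.Ici 0) := by
  have hc := continuousOn_inner_adj S Q h h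
  intro t ht
  have h1 := intervalIntegral.continuousOn_primitive_interval' (μ := volume) (a := 0) (b₁ := 0)
    (b₂ := t + 1) (intervalIntegrable_of_continuousOn_Ici hc le_rfl
      (add_nonneg ht zero_le_one)) Set.left_mem_uIcc
  rw [Set.uIcc_of_le (add_nonneg ht zero_le_one)] at h1
  have h2 : ContinuousOn (fun s => covForm S Q s h) (Set.Icc 0 (t + 1)) :=
    h1.congr fun s hs => covForm_eq S Q hs.1 h
  exact (h2 t ⟨ht, by linarith⟩).mono_of_mem_nhdsWithin
    (inter_mem_nhdsWithin _ (Iic_mem_nhds (by linarith)))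

end Covariance

/-! ### Algebra of C_b(H) and of π-limits. -/

section BoundedFunctions

variable {H : Type u} [NormedAddCommGroup H]

theorem const_mem_Cb (c : ℝ) : (fun _ : H => c) ∈ Cb H :=
  ⟨uniformContinuous_const, |c|, fun _ => le_rfl⟩

theorem add_mem_Cb {φ ψ : H → ℝ} (hφ : φ ∈ Cb H) (hψ : ψ ∈ Cb H) : φ + ψ ∈ Cb H := by
  obtain ⟨h1, C, hC⟩ := hφ
  obtain ⟨h2, D, hD⟩ := hψ
  exact ⟨h1.add h2, C + D, fun x => (abs_add_le _ _).trans (add_le_add (hC x) (hD x))⟩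

theorem smul_mem_Cb (c : ℝ) {φ : H → ℝ} (hφ : φ ∈ Cb H) : c • φ ∈ Cb H := by
  obtain ⟨h1, C, hC⟩ := hφ
  refine ⟨h1.const_smul c, |c| * C, fun x => ?_⟩
  rw [Pi.smul_apply, smul_eq_mul, abs_mul]
  exact mul_le_mul_of_nonneg_left (hC x) (abs_nonneg c)

theorem sub_mem_Cb {φ ψ : H → ℝ} (hφ : φ ∈ Cb H) (hψ : ψ ∈ Cb H) : φ - ψ ∈ Cb H := by
  have := add_mem_Cb hφ (smul_mem_Cb (-1) hψ)
  rwa [neg_one_smul, ← sub_eq_add_neg] at this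

theorem Cb.continuous {φ : H → ℝ} (hφ : φ ∈ Cb H) : Continuous φ := hφ.1.continuous

theorem Cb.integrable [MeasurableSpace H] [BorelSpace H] {φ : H → ℝ} (hφ : φ ∈ Cb H)
    {μ : Measure H} [IsFiniteMeasure μ] (z : H) : Integrable (fun y => φ (z + y)) μ := by
  obtain ⟨C, hC⟩ := hφ.2
  exact Integrable.of_bound (C := C)
    ((Cb.continuous hφ).comp (continuous_const_add z)).aestronglyMeasurable (ae_of_all _ fun y => hC _)

theorem PiTendsto.add {φ ψ : ℕ → H → ℝ} {f g : H → ℝ} (h1 : PiTendsto φ f)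
    (h2 : PiTendsto ψ g) : PiTendsto (fun n => φ n + ψ n) (f + g) := by
  obtain ⟨a1, b1, c1, C, d1⟩ := h1
  obtain ⟨a2, b2, c2, D, d2⟩ := h2
  exact ⟨fun n => add_mem_Cb (a1 n) (a2 n), add_mem_Cb b1 b2, fun x => (c1 x).add (c2 x), C + D,
    fun n x => (abs_add_le _ _).trans (add_le_add (d1 n x) (d2 n x))⟩

theorem PiTendsto.const_smul {φ : ℕ → H → ℝ} {f : H → ℝ} (h : PiTendsto φ f) (c : ℝ) :
    PiTendsto (fun n => c • φ n) (c • f) := by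
  obtain ⟨a, b, d, C, e⟩ := h
  refine ⟨fun n => smul_mem_Cb c (a n), smul_mem_Cb c b, fun x => (d x).const_mul c, |c| * C,
    fun n x => ?_⟩
  exact (abs_mul c (φ n x)).trans_le (mul_le_mul_of_nonneg_left (e n x) (abs_nonneg c))

theorem PiTendsto.sub {φ ψ : ℕ → H → ℝ} {f g : H → ℝ} (h1 : PiTendsto φ f)
    (h2 : PiTendsto ψ g) : PiTendsto (fun n => φ n - ψ n) (f - g) := by
  have := h1.add (h2.const_smul (-1))
  simpa only [neg_one_smul, ← sub_eq_add_neg] using this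

/-- `Fin.cons` peels off index 0, so `ν 0` belongs to the outer limit and `ν 1` to the inner one,
taken first. -/
theorem multiPiTendsto_two {F : ℕ → ℕ → H → ℝ} {G : ℕ → H → ℝ} {f : H → ℝ}
    (h1 : ∀ k, PiTendsto (F k) (G k)) (h2 : PiTendsto G f) :
    MultiPiTendsto 2 (fun ν => F (ν 0) (ν 1)) f :=
  ⟨G, fun k => ⟨F k, fun _ => rfl, h1 k⟩, h2⟩

theorem piClosure_subset_Cb (D : Set (H → ℝ)) : piClosure D ⊆ Cb H := by
  rintro f ⟨m, hm, φ, -, h⟩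
  obtain ⟨m, rfl⟩ := Nat.exists_eq_succ_of_ne_zero hm.ne'
  obtain ⟨ψ, -, h⟩ := h
  exact h.2.1

end BoundedFunctions

/-! ### The Ornstein–Uhlenbeck semigroup on C_b(H) and on cosines. -/

section OU

variable {H : Type u} [NormedAddCommGroup H] [InnerProductSpace ℝ H]

/-- The function `x ↦ cos (⟨x, h⟩ + θ)`. -/
def trig (θ : ℝ) (h x : H) : ℝ := Real.cos (⟪x, h⟫ + θ)

theorem trig_mem_Cb (θ : ℝ) (h : H) : trig θ h ∈ Cb H := by
  refine ⟨?_, 1, fun x => Real.abs_cos_le_one _⟩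
  refine Real.lipschitzWith_cos.uniformContinuous.comp (UniformContinuous.add_const ?_ θ)
  have : (fun x : H => ⟪x, h⟫) = innerSL ℝ h := by ext x; rw [real_inner_comm]; rfl
  rw [this]
  exact (innerSL ℝ h).uniformContinuous

variable [CompleteSpace H] [MeasurableSpace H]

/-- The Gaussian measures `N_{Q_t}` are the ones expected. -/
def HasGaussians (S : C0Semigroup H) (Q : H →L[ℝ] H) : Prop :=
  ∀ t : ℝ, 0 ≤ t → IsCenteredGaussian (covOp S Q t) (gaussianN (covOp S Q t))

variable {S : C0Semigroup H} {Q : H →L[ℝ] H}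

theorem HasGaussians.isProbabilityMeasure (hN : HasGaussians S Q) {t : ℝ} (ht : 0 ≤ t) :
    IsProbabilityMeasure (gaussianN (covOp S Q t)) := by
  have := (hN t ht).1
  infer_instance

theorem HasGaussians.abs_ou_le (hN : HasGaussians S Q) {t : ℝ} (ht : 0 ≤ t) {φ : H → ℝ} {C : ℝ}
    (hC : ∀ x, |φ x| ≤ C) (x : H) : |ouSemigroup S Q t φ x| ≤ C := by
  have := hN.isProbabilityMeasure ht
  have := norm_integral_le_of_norm_le_const (μ := gaussianN (covOp S Q t))
    (f := fun y => φ (S.op t x + y)) (ae_of_all _ fun y => hC _)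
  simpa [ouSemigroup] using this

theorem ou_smul (t : ℝ) (c : ℝ) (φ : H → ℝ) :
    ouSemigroup S Q t (c • φ) = c • ouSemigroup S Q t φ := by
  ext x
  exact integral_const_mul _ _

variable [BorelSpace H]

theorem hasGaussians_of_isTraceClass [SecondCountableTopology H] (hQ : Q.IsPositive)
    (hQt : ∀ t : ℝ, 0 < t → IsTraceClass (covOp S Q t)) : HasGaussians S Q := by
  classical
  intro t ht
  have hex : ∃ μ : Measure H, IsCenteredGaussian (covOp S Q t) μ := by
    obtain ⟨T, hT, hTp⟩ := exists_covOp_clm S hQ ht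
    rw [← hT]
    refine exists_isCenteredGaussian T hTp ?_
    rw [hT]
    -- The trace hypothesis covers t > 0 only; at t = 0 the covariance operator vanishes.
    rcases ht.eq_or_lt with rfl | ht
    · intro ι e f _ _
      simp [covOp, summable_zero]
    · exact hQt t ht
  rw [gaussianN, dif_pos hex]
  exact Classical.choose_spec hex

theorem HasGaussians.charFun_eq (hN : HasGaussians S Q) {t : ℝ} (ht : 0 ≤ t) (h : H) :
    charFun (gaussianN (covOp S Q t)) h = Complex.exp (-(covForm S Q t h : ℝ) / 2) := by
  obtain ⟨hg, hm, hc⟩ := hN t ht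
  have := hg
  have h1 : ∫ y, ⟪h, y⟫ ∂(gaussianN (covOp S Q t)) = 0 := by
    simpa only [real_inner_comm] using hm h
  rw [IsGaussian.charFun_eq, integral_complex_ofReal, h1,
    variance_of_integral_eq_zero (by fun_prop) h1]
  have h2 : ∫ y, ⟪h, y⟫ ^ 2 ∂(gaussianN (covOp S Q t)) = covForm S Q t h := by
    rw [covForm, ← hc h h]; congr 1; ext y; rw [sq, real_inner_comm]
  rw [h2]; congr 1; push_cast; ring

/-- The integrand `R_s cos (⟨·, h⟩ + θ)` of the functions spanning `I_A(H)`. -/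
def dampedCos (S : C0Semigroup H) (Q : H →L[ℝ] H) (θ : ℝ) (h : H) (s : ℝ) (x : H) : ℝ :=
  Real.exp (-covForm S Q s h / 2) * Real.cos (⟪x, S.adj s h⟫ + θ)

/-- Real part of e^{ic} times the characteristic function, which is real. -/
theorem HasGaussians.integral_cos (hN : HasGaussians S Q) {t : ℝ} (ht : 0 ≤ t) (h : H) (c : ℝ) :
    ∫ y, Real.cos (⟪y, h⟫ + c) ∂(gaussianN (covOp S Q t)) =
      Real.exp (-covForm S Q t h / 2) * Real.cos c := by
  have := hN.isProbabilityMeasure ht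
  have h1 : ∀ y : H, Real.cos (⟪y, h⟫ + c) =
      (Complex.exp (c * Complex.I) * Complex.exp ((⟪y, h⟫ : ℝ) * Complex.I)).re := fun y => by
    rw [← Complex.exp_add, ← add_mul, ← Complex.ofReal_add, Complex.exp_ofReal_mul_I_re, add_comm]
  have hi : Integrable (fun y : H => Complex.exp (c * Complex.I) *
      Complex.exp ((⟪y, h⟫ : ℝ) * Complex.I)) (gaussianN (covOp S Q t)) := by
    refine Integrable.of_bound (C := 1) (by fun_prop) (ae_of_all _ fun y => ?_)
    rw [norm_mul, Complex.norm_exp_ofReal_mul_I, Complex.norm_exp_ofReal_mul_I, one_mul]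
  simp_rw [h1]
  refine (Complex.reCLM.integral_comp_comm hi).trans ?_
  rw [Complex.reCLM_apply, integral_const_mul, ← charFun_apply, hN.charFun_eq ht]
  have : (-(covForm S Q t h : ℂ) / 2) = ((-covForm S Q t h / 2 : ℝ) : ℂ) := by push_cast; ring
  rw [this, ← Complex.ofReal_exp, Complex.re_mul_ofReal, Complex.exp_ofReal_mul_I_re, mul_comm]

theorem HasGaussians.ou_trig (hN : HasGaussians S Q) {t : ℝ} (ht : 0 ≤ t) (θ : ℝ) (h : H) :
    ouSemigroup S Q t (trig θ h) = dampedCos S Q θ h t := by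
  ext x
  have : ∀ y : H, trig θ h (S.op t x + y) = Real.cos (⟪y, h⟫ + (⟪x, S.adj t h⟫ + θ)) := fun y => by
    rw [trig, inner_add_left, S.inner_adj_right]; congr 1; ring
  simp only [ouSemigroup, this]
  exact hN.integral_cos ht h _

theorem HasGaussians.ou_add (hN : HasGaussians S Q) {t : ℝ} (ht : 0 ≤ t) {φ ψ : H → ℝ}
    (hφ : φ ∈ Cb H) (hψ : ψ ∈ Cb H) :
    ouSemigroup S Q t (φ + ψ) = ouSemigroup S Q t φ + ouSemigroup S Q t ψ := by
  have := hN.isProbabilityMeasure ht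
  ext x
  exact integral_add (Cb.integrable hφ _) (Cb.integrable hψ _)

/-- `R_t φ`, `t ∈ [0, a]`, are uniformly equicontinuous. -/
theorem HasGaussians.ou_equicontinuous (hN : HasGaussians S Q) (a : ℝ) {φ : H → ℝ}
    (hφ : φ ∈ Cb H) {ε : ℝ} (hε : 0 < ε) :
    ∃ δ > 0, ∀ t ∈ Set.Icc 0 a, ∀ x y : H, dist x y < δ →
      |ouSemigroup S Q t φ x - ouSemigroup S Q t φ y| ≤ ε := by
  obtain ⟨M, hM0, hM⟩ := S.exists_norm_op_le a
  obtain ⟨δ, hδ, h⟩ := Metric.uniformContinuous_iff.1 hφ.1 ε hε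
  refine ⟨δ / (M + 1), by positivity, fun t ht x y hxy => ?_⟩
  have := hN.isProbabilityMeasure ht.1
  rw [ouSemigroup, ouSemigroup, ← integral_sub (Cb.integrable hφ _) (Cb.integrable hφ _)]
  have := norm_integral_le_of_norm_le_const (μ := gaussianN (covOp S Q t))
    (f := fun z => φ (S.op t x + z) - φ (S.op t y + z)) (C := ε) (ae_of_all _ fun z => by
      rw [← dist_eq_norm]
      refine (h ?_).le
      rw [dist_add_right, dist_eq_norm, ← map_sub]
      rw [dist_eq_norm, lt_div_iff₀ (by positivity)] at hxy
      have := (S.op t).le_of_opNorm_le (hM t ht) (x - y)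
      nlinarith [norm_nonneg (x - y)])
  simpa using this

theorem HasGaussians.ou_mem_Cb (hN : HasGaussians S Q) {t : ℝ} (ht : 0 ≤ t) {φ : H → ℝ}
    (hφ : φ ∈ Cb H) : ouSemigroup S Q t φ ∈ Cb H := by
  obtain ⟨C, hC⟩ := hφ.2
  refine ⟨Metric.uniformContinuous_iff.2 fun ε hε => ?_, C, hN.abs_ou_le ht hC⟩
  obtain ⟨δ, hδ, h⟩ := hN.ou_equicontinuous t hφ (half_pos hε)
  exact ⟨δ, hδ, fun {x y} hxy => (h t ⟨ht, le_rfl⟩ x y hxy).trans_lt (half_lt_self hε)⟩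

/-- Dominated convergence: a uniform bound is integrable against the probability measure N_{Q_t}. -/
theorem HasGaussians.ou_tendsto (hN : HasGaussians S Q) {t : ℝ} (ht : 0 ≤ t) {φ : ℕ → H → ℝ}
    {f : H → ℝ} (h : PiTendsto φ f) :
    PiTendsto (fun n => ouSemigroup S Q t (φ n)) (ouSemigroup S Q t f) := by
  obtain ⟨h1, h2, h3, C, h4⟩ := h
  have := hN.isProbabilityMeasure ht
  refine ⟨fun n => hN.ou_mem_Cb ht (h1 n), hN.ou_mem_Cb ht h2, fun x => ?_, C,
    fun n x => hN.abs_ou_le ht (h4 n) x⟩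
  exact tendsto_integral_of_dominated_convergence (fun _ => C)
    (fun n => (Cb.integrable (h1 n) _).1) (integrable_const C)
    (fun n => ae_of_all _ fun y => h4 n _) (ae_of_all _ fun y => h3 _)

end OU

/-! ### The generator as a relation. -/

section Generator

variable {H : Type u} [NormedAddCommGroup H]

/-- `g` is the image of `φ` under the infinitesimal generator of `P`. -/
def HasGen (P : ℝ → (H → ℝ) → H → ℝ) (φ g : H → ℝ) : Prop :=
  φ ∈ Cb H ∧ g ∈ Cb H ∧
    (∀ x, Tendsto (fun t : ℝ => (P t φ x - φ x) / t) (𝓝[>] 0) (𝓝 (g x))) ∧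
    ∃ C : ℝ, ∀ t ∈ Set.Ioo (0 : ℝ) 1, ∀ x, |(P t φ x - φ x) / t| ≤ C

theorem HasGen.mem_genDomain {P : ℝ → (H → ℝ) → H → ℝ} {φ g : H → ℝ} (h : HasGen P φ g) :
    φ ∈ genDomain P :=
  ⟨h.1, ⟨g, h.2.1, h.2.2.1⟩, h.2.2.2⟩

theorem HasGen.gen_eq {P : ℝ → (H → ℝ) → H → ℝ} {φ g : H → ℝ} (h : HasGen P φ g) :
    gen P φ = g :=
  funext fun x => (h.2.2.1 x).limUnder_eq

theorem exists_hasGen_of_mem_genDomain {P : ℝ → (H → ℝ) → H → ℝ} {φ : H → ℝ}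
    (h : φ ∈ genDomain P) : HasGen P φ (gen P φ) := by
  obtain ⟨h1, ⟨g, h2, h3⟩, h4⟩ := h
  have : HasGen P φ g := ⟨h1, h2, h3, h4⟩
  rwa [this.gen_eq]

end Generator

/-! ### Integrated cosines as generators of I_A(H). -/

section IntegratedSemigroup

variable {H : Type u} [NormedAddCommGroup H] [InnerProductSpace ℝ H] [CompleteSpace H]
  (S : C0Semigroup H) (Q : H →L[ℝ] H)

theorem continuousOn_dampedCos (θ : ℝ) (h x : H) :
    ContinuousOn (fun s => dampedCos S Q θ h s x) (Set.Ici 0) := by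
  have h1 := continuousOn_covForm S Q h
  have h2 := S.continuousOn_adj h
  unfold dampedCos
  fun_prop

theorem dampedCos_zero (θ : ℝ) (h : H) : dampedCos S Q θ h 0 = trig θ h := by
  ext x
  rw [dampedCos, covForm_zero, S.adj_zero, neg_zero, zero_div, Real.exp_zero, one_mul, trig]

theorem dampedCos_eq_smul (θ : ℝ) (h : H) (s : ℝ) :
    dampedCos S Q θ h s = Real.exp (-covForm S Q s h / 2) • trig θ (S.adj s h) := rfl

variable {Q} in
theorem abs_dampedCos_le (hQ : Q.IsPositive) (θ : ℝ) (h : H) {s : ℝ} (hs : 0 ≤ s) (x : H) :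
    |dampedCos S Q θ h s x| ≤ 1 := by
  rw [dampedCos, abs_mul, abs_of_pos (Real.exp_pos _)]
  have h1 : Real.exp (-covForm S Q s h / 2) ≤ 1 :=
    Real.exp_le_one_iff.2 (by linarith [covForm_nonneg S hQ hs h])
  exact mul_le_one₀ h1 (abs_nonneg _) (Real.abs_cos_le_one _)

theorem dampedCos_mem_Cb (θ : ℝ) (h : H) (s : ℝ) : dampedCos S Q θ h s ∈ Cb H :=
  smul_mem_Cb _ (trig_mem_Cb _ _)

/-- `x ↦ ∫_0^a exp (-⟨Q_s h, h⟩ / 2) cos (⟨e^{sA} x, h⟩ + θ) ds`. -/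
def cosInt (θ : ℝ) (h : H) (a : ℝ) (x : H) : ℝ := ∫ s in (0 : ℝ)..a, dampedCos S Q θ h s x

theorem expInt_re {a : ℝ} (ha : 0 ≤ a) (h x : H) :
    (expInt S Q a h x).re = cosInt S Q 0 h a x ∧
      (expInt S Q a h x).im = cosInt S Q (-(Real.pi / 2)) h a x := by
  have h1 := continuousOn_covForm S Q h
  have h2 := S.continuousOn_op x
  have hi : IntervalIntegrable (fun s => Complex.exp (Complex.I * (⟪S.op s x, h⟫ : ℝ) -
      (1 / 2 : ℂ) * (⟪covOp S Q s h, h⟫ : ℝ))) volume 0 a := by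
    refine intervalIntegrable_of_continuousOn_Ici ?_ le_rfl ha
    change ContinuousOn (fun s => Complex.exp (Complex.I * (⟪S.op s x, h⟫ : ℝ) -
      (1 / 2 : ℂ) * (covForm S Q s h : ℝ))) _
    fun_prop
  have e : ∀ s, Complex.exp (Complex.I * (⟪S.op s x, h⟫ : ℝ) -
      (1 / 2 : ℂ) * (⟪covOp S Q s h, h⟫ : ℝ)) =
      (Real.exp (-covForm S Q s h / 2) : ℝ) * Complex.exp ((⟪x, S.adj s h⟫ : ℝ) * Complex.I) := by
    intro s
    rw [Complex.ofReal_exp, ← Complex.exp_add, S.inner_adj_right, covForm]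
    congr 1; push_cast; ring
  constructor
  · refine (Complex.reCLM.intervalIntegral_comp_comm hi).symm.trans
      (intervalIntegral.integral_congr fun s _ => ?_)
    simp only [Complex.reCLM_apply]
    rw [e, Complex.re_ofReal_mul, Complex.exp_ofReal_mul_I_re, dampedCos, add_zero]
  · refine (Complex.imCLM.intervalIntegral_comp_comm hi).symm.trans
      (intervalIntegral.integral_congr fun s _ => ?_)
    simp only [Complex.imCLM_apply]
    rw [e, Complex.im_ofReal_mul, Complex.exp_ofReal_mul_I_im, dampedCos, ← sub_eq_add_neg,
      Real.cos_sub_pi_div_two]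

/-- The cosine addition formula under the integral: every phase θ is obtained from the real and
imaginary parts, so all phases can be treated at once. -/
theorem cosInt_eq_re_im (θ : ℝ) {a : ℝ} (ha : 0 ≤ a) (h : H) :
    cosInt S Q θ h a = Real.cos θ • (fun x => (expInt S Q a h x).re) -
      Real.sin θ • (fun x => (expInt S Q a h x).im) := by
  ext x
  simp only [Pi.sub_apply, Pi.smul_apply, smul_eq_mul, (expInt_re S Q ha h x).1,
    (expInt_re S Q ha h x).2, cosInt]
  have hi := fun θ => intervalIntegrable_of_continuousOn_Ici (continuousOn_dampedCos S Q θ h x)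
    le_rfl ha
  rw [← intervalIntegral.integral_const_mul, ← intervalIntegral.integral_const_mul,
    ← intervalIntegral.integral_sub ((hi _).const_mul _) ((hi _).const_mul _)]
  refine intervalIntegral.integral_congr fun s _ => ?_
  simp only [dampedCos]
  rw [← sub_eq_add_neg, Real.cos_sub_pi_div_two, Real.cos_add, add_zero]
  ring

theorem cosInt_mem_IA (θ : ℝ) {a : ℝ} (ha : 0 ≤ a) {h : H} (hh : h ∈ S.adjDom) :
    cosInt S Q θ h a ∈ IA S Q := by
  rcases ha.eq_or_lt with rfl | ha
  · have : cosInt S Q θ h 0 = 0 := by ext x; simp [cosInt]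
    rw [this]; exact zero_mem _
  · rw [cosInt_eq_re_im S Q θ ha.le]
    exact sub_mem (Submodule.smul_mem _ _ (Submodule.subset_span ⟨a, ha, h, hh, Or.inl rfl⟩))
      (Submodule.smul_mem _ _ (Submodule.subset_span ⟨a, ha, h, hh, Or.inr rfl⟩))

variable {S Q} in
-- The real and imaginary parts are the phases 0 and -π/2 of one family, so only integrated cosines
-- have to be checked.
theorem IA_induction {p : (H → ℝ) → Prop} (hzero : p 0) (hadd : ∀ φ ψ, p φ → p ψ → p (φ + ψ))
    (hsmul : ∀ (c : ℝ) φ, p φ → p (c • φ))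
    (hcos : ∀ (θ : ℝ) (a : ℝ), 0 < a → ∀ h ∈ S.adjDom, p (cosInt S Q θ h a))
    {φ : H → ℝ} (hφ : φ ∈ IA S Q) : p φ := by
  refine Submodule.span_induction (p := fun φ _ => p φ) ?_ hzero
    (fun _ _ _ _ => hadd _ _) (fun _ _ _ => hsmul _ _) hφ
  rintro φ ⟨a, ha, h, hh, rfl | rfl⟩
  · convert hcos 0 a ha h hh using 1
    ext x; exact (expInt_re S Q ha.le h x).1
  · convert hcos (-(Real.pi / 2)) a ha h hh using 1
    ext x; exact (expInt_re S Q ha.le h x).2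

variable {S Q} [MeasurableSpace H] [BorelSpace H]

theorem HasGaussians.ou_dampedCos (hN : HasGaussians S Q) (θ : ℝ) (h : H) {s t : ℝ}
    (hs : 0 ≤ s) (ht : 0 ≤ t) :
    ouSemigroup S Q t (dampedCos S Q θ h s) = dampedCos S Q θ h (s + t) := by
  rw [dampedCos_eq_smul, ou_smul, hN.ou_trig ht, dampedCos_eq_smul, dampedCos_eq_smul, smul_smul,
    ← Real.exp_add, covForm_add S Q hs ht, S.adj_add_apply hs ht]
  congr 2; ring

/-- By Fubini and the semigroup law, R_t shifts the interval of integration from [0,a] to [t,a+t].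
-/
theorem HasGaussians.ou_cosInt (hN : HasGaussians S Q) (hQ : Q.IsPositive) (θ : ℝ) (h : H)
    {a t : ℝ} (ha : 0 ≤ a) (ht : 0 ≤ t) :
    ouSemigroup S Q t (cosInt S Q θ h a) = cosInt S Q θ h (a + t) - cosInt S Q θ h t := by
  have := hN.isProbabilityMeasure ht
  ext x
  have hI := fun {b c : ℝ} (hb : 0 ≤ b) (hc : 0 ≤ c) =>
    intervalIntegrable_of_continuousOn_Ici (continuousOn_dampedCos S Q θ h x) hb hc
  have e1 : ouSemigroup S Q t (cosInt S Q θ h a) x =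
      ∫ s in (0 : ℝ)..a, ouSemigroup S Q t (dampedCos S Q θ h s) x := by
    simp only [ouSemigroup, cosInt, intervalIntegral.integral_of_le ha]
    refine integral_integral_swap ?_
    -- Joint measurability comes from joint continuity on H × (0,a]; the bound 1 comes from Q_s ≥ 0.
    refine Integrable.of_bound (C := 1) ?_ ?_
    · rw [← Measure.restrict_univ (μ := gaussianN (covOp S Q t)), Measure.prod_restrict]
      refine ContinuousOn.aestronglyMeasurable ?_ (MeasurableSet.univ.prod measurableSet_Ioc)
      have h1 : ContinuousOn (fun p : H × ℝ => covForm S Q p.2 h) (Set.univ ×ˢ Set.Ioc 0 a) :=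
        (continuousOn_covForm S Q h).comp continuousOn_snd fun p hp => hp.2.1.le
      have h2 : ContinuousOn (fun p : H × ℝ => S.adj p.2 h) (Set.univ ×ˢ Set.Ioc 0 a) :=
        (S.continuousOn_adj h).comp continuousOn_snd fun p hp => hp.2.1.le
      simp only [Function.uncurry_def, dampedCos]
      fun_prop
    · rw [← Measure.restrict_univ (μ := gaussianN (covOp S Q t)), Measure.prod_restrict]
      filter_upwards [ae_restrict_mem (MeasurableSet.univ.prod measurableSet_Ioc)] with p hp
      exact abs_dampedCos_le S hQ θ h hp.2.1.le _
  rw [e1, Pi.sub_apply, cosInt, cosInt, intervalIntegral.integral_interval_sub_left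
    (hI le_rfl (add_nonneg ha ht)) (hI le_rfl ht)]
  have e2 : ∀ s ∈ Set.uIcc 0 a, ouSemigroup S Q t (dampedCos S Q θ h s) x =
      (fun s => dampedCos S Q θ h s x) (s + t) := fun s hs => by
    rw [Set.uIcc_of_le ha] at hs
    simp only [hN.ou_dampedCos θ h hs.1 ht]
  rw [intervalIntegral.integral_congr e2, intervalIntegral.integral_comp_add_right
    (fun s => dampedCos S Q θ h s x), zero_add]

end IntegratedSemigroup

/-! ### The generator on I_A(H) and the integrated semigroup. -/

section GeneratorLinear

variable {H : Type u} [NormedAddCommGroup H] [InnerProductSpace ℝ H] [CompleteSpace H]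
  [MeasurableSpace H] [BorelSpace H] {S : C0Semigroup H} {Q : H →L[ℝ] H}

omit [BorelSpace H] in
theorem hasGen_zero : HasGen (ouSemigroup S Q) 0 0 := by
  refine ⟨const_mem_Cb 0, const_mem_Cb 0, fun x => ?_, 0, fun t _ x => ?_⟩
  · simp [ouSemigroup]
  · simp [ouSemigroup]

theorem HasGaussians.hasGen_add (hN : HasGaussians S Q) {φ ψ f g : H → ℝ}
    (h1 : HasGen (ouSemigroup S Q) φ f) (h2 : HasGen (ouSemigroup S Q) ψ g) :
    HasGen (ouSemigroup S Q) (φ + ψ) (f + g) := by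
  obtain ⟨a1, b1, c1, C, d1⟩ := h1
  obtain ⟨a2, b2, c2, D, d2⟩ := h2
  have e : ∀ t : ℝ, 0 < t → ∀ x, (ouSemigroup S Q t (φ + ψ) x - (φ + ψ) x) / t =
      (ouSemigroup S Q t φ x - φ x) / t + (ouSemigroup S Q t ψ x - ψ x) / t := fun t ht x => by
    rw [hN.ou_add ht.le a1 a2, Pi.add_apply, Pi.add_apply]; ring
  refine ⟨add_mem_Cb a1 a2, add_mem_Cb b1 b2, fun x => ?_, C + D, fun t ht x => ?_⟩
  · refine ((c1 x).add (c2 x)).congr' ?_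
    filter_upwards [self_mem_nhdsWithin] with t ht using (e t ht x).symm
  · rw [e t ht.1]
    exact (abs_add_le _ _).trans (add_le_add (d1 t ht x) (d2 t ht x))

omit [BorelSpace H] in
theorem hasGen_smul (c : ℝ) {φ f : H → ℝ} (h : HasGen (ouSemigroup S Q) φ f) :
    HasGen (ouSemigroup S Q) (c • φ) (c • f) := by
  obtain ⟨a, b, d, C, e⟩ := h
  have e1 : ∀ (t : ℝ) x, (ouSemigroup S Q t (c • φ) x - (c • φ) x) / t =
      c * ((ouSemigroup S Q t φ x - φ x) / t) := fun t x => by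
    rw [ou_smul, Pi.smul_apply, Pi.smul_apply, smul_eq_mul, smul_eq_mul]; ring
  refine ⟨smul_mem_Cb c a, smul_mem_Cb c b, fun x => ?_, |c| * C, fun t ht x => ?_⟩
  · simp only [e1]
    exact (d x).const_mul c
  · rw [e1, abs_mul]
    exact mul_le_mul_of_nonneg_left (e t ht x) (abs_nonneg c)

/-- `x ↦ ∫_0^a R_s φ (x) ds`. -/
def integratedOU (S : C0Semigroup H) (Q : H →L[ℝ] H) (a : ℝ) (φ : H → ℝ) (x : H) : ℝ :=
  ∫ s in (0 : ℝ)..a, ouSemigroup S Q s φ x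

/-- The orbits `s ↦ R_s φ (x)`, `s ≥ 0`, are measurable. -/
def MeasurableOrbits (S : C0Semigroup H) (Q : H →L[ℝ] H) (φ : H → ℝ) : Prop :=
  ∀ x, AEStronglyMeasurable (fun s => ouSemigroup S Q s φ x) (volume.restrict (Set.Ioi 0))

omit [BorelSpace H] in
theorem HasGaussians.intervalIntegrable_orbit (hN : HasGaussians S Q) {φ : H → ℝ} (hφ : φ ∈ Cb H)
    (hm : MeasurableOrbits S Q φ) {a : ℝ} (ha : 0 ≤ a) (x : H) :
    IntervalIntegrable (fun s => ouSemigroup S Q s φ x) volume 0 a := by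
  obtain ⟨C, hC⟩ := hφ.2
  rw [intervalIntegrable_iff_integrableOn_Ioc_of_le ha]
  refine Integrable.of_bound (C := C) ((hm x).mono_measure
    (Measure.restrict_mono Set.Ioc_subset_Ioi_self le_rfl)) ?_
  filter_upwards [ae_restrict_mem measurableSet_Ioc] with s hs using hN.abs_ou_le hs.1.le hC x

omit [BorelSpace H] in
theorem HasGaussians.abs_integratedOU_le (hN : HasGaussians S Q) {φ : H → ℝ} {C : ℝ}
    (hC : ∀ x, |φ x| ≤ C) {a : ℝ} (ha : 0 ≤ a) (x : H) : |integratedOU S Q a φ x| ≤ C * a := by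
  have := intervalIntegral.norm_integral_le_of_norm_le_const (a := 0) (b := a) (C := C)
    (f := fun s => ouSemigroup S Q s φ x) fun s hs => by
      rw [Set.uIoc_of_le ha] at hs
      exact hN.abs_ou_le hs.1.le hC x
  rwa [sub_zero, abs_of_nonneg ha] at this

theorem HasGaussians.integratedOU_mem_Cb (hN : HasGaussians S Q) {φ : H → ℝ} (hφ : φ ∈ Cb H)
    (hm : MeasurableOrbits S Q φ) {a : ℝ} (ha : 0 ≤ a) : integratedOU S Q a φ ∈ Cb H := by
  obtain ⟨C, hC⟩ := hφ.2
  refine ⟨Metric.uniformContinuous_iff.2 fun ε hε => ?_, C * a, hN.abs_integratedOU_le hC ha⟩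
  obtain ⟨δ, hδ, h⟩ := hN.ou_equicontinuous a hφ (ε := ε / (a + 1)) (by positivity)
  refine ⟨δ, hδ, fun {x y} hxy => ?_⟩
  rw [dist_eq_norm, integratedOU, integratedOU, ← intervalIntegral.integral_sub
    (hN.intervalIntegrable_orbit hφ hm ha x) (hN.intervalIntegrable_orbit hφ hm ha y)]
  have := intervalIntegral.norm_integral_le_of_norm_le_const (a := 0) (b := a) (C := ε / (a + 1))
    (f := fun s => ouSemigroup S Q s φ x - ouSemigroup S Q s φ y) fun s hs => by
      rw [Set.uIoc_of_le ha] at hs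
      exact h s ⟨hs.1.le, hs.2⟩ x y hxy
  refine this.trans_lt ?_
  rw [sub_zero, abs_of_nonneg ha, div_mul_eq_mul_div, div_lt_iff₀ (by positivity)]
  nlinarith

theorem HasGaussians.measurableOrbits_trig (hN : HasGaussians S Q) (θ : ℝ) (h : H) :
    MeasurableOrbits S Q (trig θ h) := fun x => by
  refine ContinuousOn.aestronglyMeasurable ?_ measurableSet_Ioi
  refine ((continuousOn_dampedCos S Q θ h x).mono Set.Ioi_subset_Ici_self).congr fun s hs => ?_
  rw [hN.ou_trig (le_of_lt hs)]

theorem HasGaussians.integratedOU_trig (hN : HasGaussians S Q) (θ : ℝ) (h : H) {a : ℝ}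
    (ha : 0 ≤ a) : integratedOU S Q a (trig θ h) = cosInt S Q θ h a := by
  ext x
  refine intervalIntegral.integral_congr fun s hs => ?_
  rw [Set.uIcc_of_le ha] at hs
  simp only [hN.ou_trig hs.1]

theorem HasGaussians.cosInt_mem_Cb (hN : HasGaussians S Q) (θ : ℝ) (h : H) {a : ℝ}
    (ha : 0 ≤ a) : cosInt S Q θ h a ∈ Cb H := by
  rw [← hN.integratedOU_trig θ h ha]
  exact hN.integratedOU_mem_Cb (trig_mem_Cb θ h) (hN.measurableOrbits_trig θ h) ha

/-- After the shift of the interval, the difference quotient is the average of the orbit over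
[a,a+t] minus that over [0,t]. Right continuity gives the limit; each average is at most 1 in
modulus, whence the constant 2. -/
theorem HasGaussians.hasGen_cosInt (hN : HasGaussians S Q) (hQ : Q.IsPositive) (θ : ℝ) (h : H)
    {a : ℝ} (ha : 0 ≤ a) :
    HasGen (ouSemigroup S Q) (cosInt S Q θ h a) (dampedCos S Q θ h a - trig θ h) := by
  have hI := fun {b c : ℝ} (hb : 0 ≤ b) (hc : 0 ≤ c) (x : H) =>
    intervalIntegrable_of_continuousOn_Ici (continuousOn_dampedCos S Q θ h x) hb hc
  have e : ∀ t : ℝ, 0 < t → ∀ x, (ouSemigroup S Q t (cosInt S Q θ h a) x - cosInt S Q θ h a x) / t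
      = (t⁻¹ • ∫ s in a..(a + t), dampedCos S Q θ h s x) -
        (t⁻¹ • ∫ s in (0 : ℝ)..(0 + t), dampedCos S Q θ h s x) := fun t ht x => by
    have e2 := intervalIntegral.integral_add_adjacent_intervals (hI le_rfl ha x)
      (hI ha (add_nonneg ha ht.le) x)
    rw [hN.ou_cosInt hQ θ h ha ht.le, Pi.sub_apply, cosInt, cosInt, cosInt, ← e2, zero_add,
      smul_eq_mul, smul_eq_mul]
    ring
  refine ⟨hN.cosInt_mem_Cb θ h ha, sub_mem_Cb (dampedCos_mem_Cb S Q θ h a) (trig_mem_Cb θ h),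
    fun x => ?_, 2, fun t ht x => ?_⟩
  · rw [Pi.sub_apply, ← dampedCos_zero S Q]
    refine ((tendsto_average_of_continuousOn (continuousOn_dampedCos S Q θ h x) ha).sub
      (tendsto_average_of_continuousOn (continuousOn_dampedCos S Q θ h x) le_rfl)).congr' ?_
    filter_upwards [self_mem_nhdsWithin] with t ht using (e t ht x).symm
  · rw [e t ht.1]
    have hb : ∀ b : ℝ, 0 ≤ b → |t⁻¹ • ∫ s in b..(b + t), dampedCos S Q θ h s x| ≤ 1 := by
      intro b hb
      have := intervalIntegral.norm_integral_le_of_norm_le_const (a := b) (b := b + t) (C := 1)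
        (f := fun s => dampedCos S Q θ h s x) fun s hs => by
          rw [Set.uIoc_of_le (by linarith [ht.1])] at hs
          exact abs_dampedCos_le S hQ θ h (hb.trans hs.1.le) x
      rw [add_sub_cancel_left, abs_of_pos ht.1, one_mul] at this
      rw [smul_eq_mul, abs_mul, abs_of_pos (inv_pos.2 ht.1), inv_mul_le_iff₀ ht.1, mul_one]
      exact this
    exact (abs_sub _ _).trans (by linarith [hb a ha, hb 0 le_rfl])

theorem HasGaussians.exists_hasGen_of_mem_IA (hN : HasGaussians S Q) (hQ : Q.IsPositive)
    {φ : H → ℝ} (hφ : φ ∈ IA S Q) : ∃ g, HasGen (ouSemigroup S Q) φ g :=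
  IA_induction (p := fun φ => ∃ g, HasGen (ouSemigroup S Q) φ g) ⟨0, hasGen_zero⟩
    (fun _ _ ⟨_, h1⟩ ⟨_, h2⟩ => ⟨_, hN.hasGen_add h1 h2⟩) (fun c _ ⟨_, h⟩ => ⟨_, hasGen_smul c h⟩)
    (fun θ _ ha h _ => ⟨_, hN.hasGen_cosInt hQ θ h ha.le⟩) hφ

theorem HasGaussians.ou_mem_IA (hN : HasGaussians S Q) (hQ : Q.IsPositive) {t : ℝ} (ht : 0 ≤ t)
    {φ : H → ℝ} (hφ : φ ∈ IA S Q) : ouSemigroup S Q t φ ∈ IA S Q := by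
  refine (IA_induction (p := fun φ => φ ∈ Cb H ∧ ouSemigroup S Q t φ ∈ IA S Q)
    ⟨const_mem_Cb 0, ?_⟩ (fun φ ψ h1 h2 => ⟨add_mem_Cb h1.1 h2.1, ?_⟩)
    (fun c φ h => ⟨smul_mem_Cb c h.1, ?_⟩)
    (fun θ a ha h hh => ⟨hN.cosInt_mem_Cb θ h ha.le, ?_⟩) hφ).2
  · have : ouSemigroup S Q t 0 = 0 := by ext x; simp [ouSemigroup]
    rw [this]; exact zero_mem _
  · rw [hN.ou_add ht h1.1 h2.1]; exact add_mem h1.2 h2.2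
  · rw [ou_smul]; exact Submodule.smul_mem _ _ h.2
  · rw [hN.ou_cosInt hQ θ h ha.le ht]
    exact sub_mem (cosInt_mem_IA S Q θ (add_nonneg ha.le ht) hh) (cosInt_mem_IA S Q θ ht hh)

end GeneratorLinear

/-! ### π-density of trigonometric polynomials. -/

section TrigonometricPolynomials

variable {H : Type u} [NormedAddCommGroup H] [InnerProductSpace ℝ H]

/-- Trigonometric polynomials with frequencies in `V`. -/
def trigSpan (V : Submodule ℝ H) : Submodule ℝ (H → ℝ) :=
  Submodule.span ℝ {φ | ∃ θ : ℝ, ∃ h ∈ V, φ = trig θ h}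

theorem trig_mem_trigSpan {V : Submodule ℝ H} (θ : ℝ) {h : H} (hh : h ∈ V) :
    trig θ h ∈ trigSpan V :=
  Submodule.subset_span ⟨θ, h, hh, rfl⟩

theorem trigSpan_induction {V : Submodule ℝ H} {p : (H → ℝ) → Prop} (hzero : p 0)
    (hadd : ∀ φ ψ, p φ → p ψ → p (φ + ψ)) (hsmul : ∀ (c : ℝ) φ, p φ → p (c • φ))
    (htrig : ∀ (θ : ℝ), ∀ h ∈ V, p (trig θ h)) {φ : H → ℝ} (hφ : φ ∈ trigSpan V) : p φ := by
  refine Submodule.span_induction (p := fun φ _ => p φ) ?_ hzero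
    (fun _ _ _ _ => hadd _ _) (fun _ _ _ => hsmul _ _) hφ
  rintro φ ⟨θ, h, hh, rfl⟩
  exact htrig θ h hh

theorem trigSpan_subset_Cb {V : Submodule ℝ H} {φ : H → ℝ} (hφ : φ ∈ trigSpan V) : φ ∈ Cb H :=
  trigSpan_induction (const_mem_Cb 0) (fun _ _ => add_mem_Cb) (fun c _ => smul_mem_Cb c)
    (fun θ h _ => trig_mem_Cb θ h) hφ

theorem trig_mul_trig (θ η : ℝ) (h k : H) :
    trig θ h * trig η k =
      (1 / 2 : ℝ) • (trig (θ + η) (h + k) + trig (θ - η) (h - k)) := by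
  ext x
  simp only [Pi.mul_apply, Pi.smul_apply, Pi.add_apply, smul_eq_mul, trig]
  have e1 : ⟪x, h + k⟫ + (θ + η) = (⟪x, h⟫ + θ) + (⟪x, k⟫ + η) := by rw [inner_add_right]; ring
  have e2 : ⟪x, h - k⟫ + (θ - η) = (⟪x, h⟫ + θ) - (⟪x, k⟫ + η) := by rw [inner_sub_right]; ring
  rw [e1, e2, Real.cos_add (⟪x, h⟫ + θ), Real.cos_sub (⟪x, h⟫ + θ)]
  ring

theorem mul_mem_trigSpan {V : Submodule ℝ H} {φ ψ : H → ℝ} (hφ : φ ∈ trigSpan V)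
    (hψ : ψ ∈ trigSpan V) : φ * ψ ∈ trigSpan V := by
  refine trigSpan_induction (p := fun φ => φ * ψ ∈ trigSpan V) (by simp)
    (fun a b ha hb => by rw [add_mul]; exact add_mem ha hb)
    (fun c a ha => by rw [smul_mul_assoc]; exact Submodule.smul_mem _ _ ha)
    (fun θ h hh => ?_) hφ
  refine trigSpan_induction (p := fun ψ => trig θ h * ψ ∈ trigSpan V) (by simp)
    (fun a b ha hb => by rw [mul_add]; exact add_mem ha hb)
    (fun c a ha => by rw [mul_smul_comm]; exact Submodule.smul_mem _ _ ha)
    (fun η k hk => ?_) hψ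
  rw [trig_mul_trig]
  exact Submodule.smul_mem _ _ (add_mem (trig_mem_trigSpan _ (add_mem hh hk))
    (trig_mem_trigSpan _ (sub_mem hh hk)))

theorem const_mem_trigSpan (V : Submodule ℝ H) (c : ℝ) : (fun _ => c) ∈ trigSpan V := by
  have : (fun _ : H => c) = c • trig 0 (0 : H) := by
    ext x; simp [trig]
  rw [this]
  exact Submodule.smul_mem _ _ (trig_mem_trigSpan _ (zero_mem V))

/-- The algebra of trigonometric polynomials with frequencies in `V`. -/
def trigAlgebra (V : Submodule ℝ H) : Subalgebra ℝ (H → ℝ) :=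
  { trigSpan V with
    mul_mem' := mul_mem_trigSpan
    algebraMap_mem' := fun c => const_mem_trigSpan V c }

/-- The frequency π(x - y)/‖x - y‖² makes the phases at x and y differ by exactly π, so the cosine
takes the values -1 and 1. -/
theorem exists_trig_ne {V : Submodule ℝ H} {x y : H} (hx : x ∈ V) (hy : y ∈ V) (hxy : x ≠ y) :
    ∃ φ ∈ trigSpan V, φ x ≠ φ y := by
  set h : H := (Real.pi / ‖x - y‖ ^ 2) • (x - y) with hh
  have hn : ‖x - y‖ ^ 2 ≠ 0 := pow_ne_zero _ (norm_ne_zero_iff.2 (sub_ne_zero.2 hxy))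
  have h1 : ⟪x, h⟫ = ⟪y, h⟫ + Real.pi := by
    have : ⟪x - y, h⟫ = Real.pi := by
      rw [hh, real_inner_smul_right, real_inner_self_eq_norm_sq, div_mul_cancel₀ _ hn]
    rw [inner_sub_left] at this
    linarith
  refine ⟨trig (-⟪y, h⟫) h, trig_mem_trigSpan _ (V.smul_mem _ (sub_mem hx hy)), ?_⟩
  have e : Real.pi + ⟪y, h⟫ + -⟪y, h⟫ = Real.pi := by ring
  rw [trig, trig, h1, add_comm ⟪y, h⟫ Real.pi, e, add_neg_cancel, Real.cos_pi, Real.cos_zero]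
  norm_num

/-- Approximation on compact sets by trigonometric polynomials, with control of the sup norm. -/
theorem exists_trigSpan_near {V : Submodule ℝ H} {K : Set H} (hK : IsCompact K) (hKV : K ⊆ V)
    {f : H → ℝ} (hf : Continuous f) {C : ℝ} (hC : ∀ x, |f x| ≤ C) {ε : ℝ} (hε : 0 < ε) :
    ∃ p ∈ trigSpan V, (∀ x ∈ K, |p x - f x| ≤ ε) ∧ ∀ x, |p x| ≤ C + ε := by
  have : CompactSpace K := isCompact_iff_compactSpace.1 hK
  have hC0 : 0 ≤ C := (abs_nonneg _).trans (hC 0)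
  let A : Subalgebra ℝ C(K, ℝ) :=
    { carrier := {g | ∃ p ∈ trigSpan V, ∀ x : K, g x = p x}
      add_mem' := by
        rintro g g' ⟨p, hp, h⟩ ⟨p', hp', h'⟩
        exact ⟨p + p', add_mem hp hp', fun x => by simp [h, h']⟩
      mul_mem' := by
        rintro g g' ⟨p, hp, h⟩ ⟨p', hp', h'⟩
        exact ⟨p * p', mul_mem_trigSpan hp hp', fun x => by simp [h, h']⟩
      algebraMap_mem' := fun c => ⟨_, const_mem_trigSpan V c, fun x => rfl⟩ }
  have hA : A.SeparatesPoints := by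
    intro x y hxy
    obtain ⟨φ, hφ, hne⟩ := exists_trig_ne (hKV x.2) (hKV y.2) (Subtype.coe_ne_coe.2 hxy)
    exact ⟨_, ⟨⟨fun z : K => φ z, (Cb.continuous (trigSpan_subset_Cb hφ)).comp
      continuous_subtype_val⟩, ⟨φ, hφ, fun _ => rfl⟩, rfl⟩, hne⟩
  obtain ⟨⟨g, p, hp, hgp⟩, hg⟩ :=
    ContinuousMap.exists_mem_subalgebra_near_continuous_of_separatesPoints A hA
      (fun x : K => f x) (hf.comp continuous_subtype_val) (ε / 2) (half_pos hε)
  obtain ⟨M, hM⟩ := (trigSpan_subset_Cb hp).2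
  -- Stone–Weierstrass controls p only on K. Composing with a polynomial close to the truncation at
  -- ±C on [-M,M], which contains the range of p, stays in the algebra and bounds the result on all
  -- of H. Truncation does not increase the error on K, since |f| ≤ C.
  obtain ⟨q, hq⟩ := exists_polynomial_near_of_continuousOn (-M) M
    (fun r => max (-C) (min r C)) (by fun_prop) (ε / 2) (half_pos hε)
  have hqe : ∀ x, Polynomial.aeval p q x = q.eval (p x) := fun x => by
    rw [Polynomial.aeval_fn_apply, Polynomial.coe_aeval_eq_eval]
  have hclamp : ∀ r : ℝ, |max (-C) (min r C)| ≤ C := fun r =>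
    abs_le.2 ⟨le_max_left _ _, max_le (by linarith) (min_le_right _ _)⟩
  refine ⟨Polynomial.aeval p q, ?_, fun x hx => ?_, fun x => ?_⟩
  · have : Polynomial.aeval p q ∈ trigAlgebra V :=
      Algebra.adjoin_le (S := trigAlgebra V) (Set.singleton_subset_iff.2 hp)
        (Polynomial.aeval_mem_adjoin_singleton ℝ p)
    exact this
  · have h1 := (hq (p x) (abs_le.1 (hM x))).le
    have h2 := (hg ⟨x, hx⟩).le
    rw [Real.norm_eq_abs] at h2
    change |g ⟨x, hx⟩ - f x| ≤ _ at h2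
    rw [hgp] at h2
    have h3 : |max (-C) (min (p x) C) - f x| ≤ |p x - f x| := by
      have e : f x = max (-C) (min (f x) C) := by
        rw [min_eq_left (abs_le.1 (hC x)).2, max_eq_right (abs_le.1 (hC x)).1]
      conv_lhs => rw [e]
      rw [max_comm (-C), max_comm (-C)]
      refine (abs_max_sub_max_le_abs _ _ _).trans ((abs_min_sub_min_le_max _ _ _ _).trans ?_)
      simp
    rw [hqe]
    calc |q.eval (p x) - f x| = |(q.eval (p x) - max (-C) (min (p x) C)) +
          (max (-C) (min (p x) C) - f x)| := by congr 1; ring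
      _ ≤ _ := (abs_add_le _ _).trans (by linarith)
  · have h1 := (hq (p x) (abs_le.1 (hM x))).le
    rw [hqe]
    have := abs_le.1 (hclamp (p x))
    have := abs_le.1 h1
    exact abs_le.2 ⟨by linarith, by linarith⟩

/-- Precomposition with P acts on the frequencies through its adjoint, so the range of the adjoint
decides where the new frequencies lie. -/
theorem trigSpan_comp {V : Submodule ℝ H} {P : H → H} {P' : H → H}
    (hP : ∀ x y, ⟪P x, y⟫ = ⟪x, P' y⟫) (hPV : ∀ y, P' y ∈ V) {W : Submodule ℝ H} {φ : H → ℝ}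
    (hφ : φ ∈ trigSpan W) : φ ∘ P ∈ trigSpan V := by
  refine trigSpan_induction (p := fun φ => φ ∘ P ∈ trigSpan V) (zero_mem _)
    (fun a b ha hb => add_mem ha hb) (fun c a ha => Submodule.smul_mem _ c ha)
    (fun θ h _ => ?_) hφ
  have : trig θ h ∘ P = trig θ (P' h) := by ext x; simp [trig, hP]
  rw [this]
  exact trig_mem_trigSpan _ (hPV h)

/-- Trigonometric polynomials with frequencies in a dense subspace are π-dense, already for
simple sequences. -/
theorem exists_trigSpan_piTendsto [TopologicalSpace.SeparableSpace H] {V : Submodule ℝ H}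
    (hV : Dense (V : Set H)) {f : H → ℝ} (hf : f ∈ Cb H) :
    ∃ p : ℕ → H → ℝ, (∀ n, p n ∈ trigSpan V) ∧ PiTendsto p f := by
  have : SecondCountableTopology H := UniformSpace.secondCountable_of_separable H
  obtain ⟨C, hC⟩ := hf.2
  let v : ℕ → V := TopologicalSpace.denseSeq V
  -- Increasing finite-dimensional subspaces of V with dense union: their closed balls are compact,
  -- their orthogonal projections tend strongly to the identity, and composing with these keeps the
  -- frequencies in V.
  let U : ℕ → Submodule ℝ H := fun n => Submodule.span ℝ ((fun i => (v i : H)) '' Set.Iio n)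
  have hUfin : ∀ n, FiniteDimensional ℝ (U n) := fun n =>
    FiniteDimensional.span_of_finite ℝ ((Set.finite_Iio n).image _)
  have hUV : ∀ n, U n ≤ V := fun n => Submodule.span_le.2 (by rintro _ ⟨i, _, rfl⟩; exact (v i).2)
  have hUmono : Monotone U := fun m n hmn =>
    Submodule.span_mono (Set.image_mono (Set.Iio_subset_Iio hmn))
  have hUdense : ⊤ ≤ (⨆ n, U n).topologicalClosure := by
    rw [top_le_iff, ← Submodule.dense_iff_topologicalClosure_eq_top]
    have h1 : Dense (Set.range fun i => (v i : H)) := by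
      have := hV.denseRange_val.comp (TopologicalSpace.denseRange_denseSeq V)
        continuous_subtype_val
      exact this
    refine h1.mono ?_
    rintro _ ⟨i, rfl⟩
    exact Submodule.mem_iSup_of_mem (i + 1)
      (Submodule.subset_span ⟨i, Nat.lt_succ_self i, rfl⟩)
  let P : ℕ → H → H := fun n => (U n).starProjection
  have hP : ∀ x, Tendsto (fun n => P n x) atTop (𝓝 x) := fun x =>
    Submodule.starProjection_tendsto_self U hUmono x hUdense
  have hPn : ∀ n x, ‖P n x‖ ≤ ‖x‖ := fun n x => Submodule.norm_starProjection_apply_le _ _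
  have key : ∀ n : ℕ, ∃ p ∈ trigSpan (U n), (∀ x ∈ ((↑) : U n → H) '' Metric.closedBall 0 n,
      |p x - f x| ≤ 1 / ((n : ℝ) + 1)) ∧ ∀ x, |p x| ≤ C + 1 / ((n : ℝ) + 1) := fun n =>
    exists_trigSpan_near ((isCompact_closedBall (0 : U n) n).image continuous_subtype_val)
      (by rintro _ ⟨y, _, rfl⟩; exact y.2) (Cb.continuous hf) hC (by positivity)
  choose p hp1 hp2 hp3 using key
  have hmem : ∀ n, p n ∘ P n ∈ trigSpan V := fun n =>
    trigSpan_comp (P' := P n) (fun x y => (U n).inner_starProjection_left_eq_right x y)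
      (fun y => hUV n ((U n).starProjection_apply_mem y)) (hp1 n)
  refine ⟨fun n => p n ∘ P n, hmem, fun n => trigSpan_subset_Cb (hmem n), hf, fun x => ?_, C + 1,
    fun n x => (hp3 n _).trans ?_⟩
  · have h1 : Tendsto (fun n => f (P n x)) atTop (𝓝 (f x)) :=
      ((Cb.continuous hf).tendsto x).comp (hP x)
    have h2 : Tendsto (fun n => p n (P n x) - f (P n x)) atTop (𝓝 0) := by
      refine squeeze_zero_norm' ?_ (tendsto_one_div_add_atTop_nhds_zero_nat (𝕜 := ℝ))
      obtain ⟨N, hN⟩ := exists_nat_ge ‖x‖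
      filter_upwards [eventually_ge_atTop N] with n hn
      refine hp2 n _ ⟨⟨P n x, (U n).starProjection_apply_mem x⟩, ?_, rfl⟩
      rw [mem_closedBall_zero_iff]
      exact (hPn n x).trans (hN.trans (by exact_mod_cast hn))
    simpa using h2.add h1
  · have : 1 / ((n : ℝ) + 1) ≤ 1 := by
      rw [div_le_one (by positivity)]; linarith [(Nat.cast_nonneg n : (0 : ℝ) ≤ n)]
    linarith

end TrigonometricPolynomials

/-! ### Averages along the semigroup and the π-core property. -/

section PiCore

variable {H : Type u} [NormedAddCommGroup H] [InnerProductSpace ℝ H] [CompleteSpace H]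
  [MeasurableSpace H] [BorelSpace H] {S : C0Semigroup H} {Q : H →L[ℝ] H}

theorem HasGaussians.continuousOn_orbit_trigSpan (hN : HasGaussians S Q) {V : Submodule ℝ H}
    {p : H → ℝ} (hp : p ∈ trigSpan V) (x : H) :
    ContinuousOn (fun s => ouSemigroup S Q s p x) (Set.Ici 0) := by
  refine (trigSpan_induction (p := fun p => p ∈ Cb H ∧
    ContinuousOn (fun s => ouSemigroup S Q s p x) (Set.Ici 0))
    ⟨const_mem_Cb 0, ?_⟩ (fun φ ψ h1 h2 => ⟨add_mem_Cb h1.1 h2.1, ?_⟩)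
    (fun c φ h => ⟨smul_mem_Cb c h.1, ?_⟩) (fun θ h _ => ⟨trig_mem_Cb θ h, ?_⟩) hp).2
  · simp only [ouSemigroup, Pi.zero_apply, integral_zero]
    exact continuousOn_const
  · refine (h1.2.add h2.2).congr fun s hs => ?_
    rw [hN.ou_add hs h1.1 h2.1]; rfl
  · simp only [ou_smul]
    exact h.2.const_smul c
  · exact (continuousOn_dampedCos S Q θ h x).congr fun s hs => by rw [hN.ou_trig hs]

theorem HasGaussians.ou_zero_trigSpan (hN : HasGaussians S Q) {V : Submodule ℝ H}
    {p : H → ℝ} (hp : p ∈ trigSpan V) : ouSemigroup S Q 0 p = p := by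
  refine (trigSpan_induction (p := fun p => p ∈ Cb H ∧ ouSemigroup S Q 0 p = p)
    ⟨const_mem_Cb 0, ?_⟩ (fun φ ψ h1 h2 => ⟨add_mem_Cb h1.1 h2.1, ?_⟩)
    (fun c φ h => ⟨smul_mem_Cb c h.1, ?_⟩) (fun θ h _ => ⟨trig_mem_Cb θ h, ?_⟩) hp).2
  · ext x; simp [ouSemigroup]
  · rw [hN.ou_add le_rfl h1.1 h2.1, h1.2, h2.2]
  · rw [ou_smul, h.2]
  · rw [hN.ou_trig le_rfl, dampedCos_zero]

theorem HasGaussians.measurableOrbits_trigSpan (hN : HasGaussians S Q) {V : Submodule ℝ H}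
    {p : H → ℝ} (hp : p ∈ trigSpan V) : MeasurableOrbits S Q p := fun x =>
  ((hN.continuousOn_orbit_trigSpan hp x).mono Set.Ioi_subset_Ici_self).aestronglyMeasurable
    measurableSet_Ioi

/-- R_s preserves π-limits, so an orbit of the limit is a pointwise limit of measurable orbits.
Measurability suffices to integrate in s, without continuity of general orbits. -/
theorem HasGaussians.measurableOrbits_of_piTendsto (hN : HasGaussians S Q) {p : ℕ → H → ℝ}
    {f : H → ℝ} (hp : ∀ n, MeasurableOrbits S Q (p n)) (h : PiTendsto p f) :
    MeasurableOrbits S Q f := fun x => by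
  refine aestronglyMeasurable_of_tendsto_ae atTop (fun n => hp n x) ?_
  filter_upwards [ae_restrict_mem measurableSet_Ioi] with s hs
  exact (hN.ou_tendsto (le_of_lt hs) h).2.2.1 x

theorem HasGaussians.integratedOU_tendsto (hN : HasGaussians S Q) {p : ℕ → H → ℝ}
    {f : H → ℝ} (hp : ∀ n, MeasurableOrbits S Q (p n)) (h : PiTendsto p f) {a : ℝ} (ha : 0 ≤ a) :
    PiTendsto (fun n => integratedOU S Q a (p n)) (integratedOU S Q a f) := by
  obtain ⟨C, hC⟩ := h.2.2.2
  refine ⟨fun n => hN.integratedOU_mem_Cb (h.1 n) (hp n) ha,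
    hN.integratedOU_mem_Cb h.2.1 (hN.measurableOrbits_of_piTendsto hp h) ha, fun x => ?_, C * a,
    fun n x => hN.abs_integratedOU_le (hC n) ha x⟩
  refine intervalIntegral.tendsto_integral_filter_of_dominated_convergence (fun _ => C)
    (Eventually.of_forall fun n => ?_) (Eventually.of_forall fun n => ae_of_all _ fun s hs => ?_)
    intervalIntegrable_const (ae_of_all _ fun s hs => ?_)
  · rw [Set.uIoc_of_le ha]
    exact (hp n x).mono_measure (Measure.restrict_mono Set.Ioc_subset_Ioi_self le_rfl)
  · rw [Set.uIoc_of_le ha] at hs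
    exact hN.abs_ou_le hs.1.le (hC n) x
  · rw [Set.uIoc_of_le ha] at hs
    exact (hN.ou_tendsto hs.1.le h).2.2.1 x

omit [BorelSpace H] in
theorem integratedOU_zero (a : ℝ) : integratedOU S Q a 0 = 0 := by
  ext x; simp [integratedOU, ouSemigroup]

theorem HasGaussians.integratedOU_add (hN : HasGaussians S Q) {φ ψ : H → ℝ} (hφ : φ ∈ Cb H)
    (hψ : ψ ∈ Cb H) (hmφ : MeasurableOrbits S Q φ) (hmψ : MeasurableOrbits S Q ψ) {a : ℝ}
    (ha : 0 ≤ a) : integratedOU S Q a (φ + ψ) = integratedOU S Q a φ + integratedOU S Q a ψ := by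
  ext x
  rw [Pi.add_apply, integratedOU, integratedOU, integratedOU, ← intervalIntegral.integral_add
    (hN.intervalIntegrable_orbit hφ hmφ ha x) (hN.intervalIntegrable_orbit hψ hmψ ha x)]
  refine intervalIntegral.integral_congr fun s hs => ?_
  rw [Set.uIcc_of_le ha] at hs
  simp only [hN.ou_add hs.1 hφ hψ, Pi.add_apply]

omit [BorelSpace H] in
theorem integratedOU_smul (a c : ℝ) (φ : H → ℝ) :
    integratedOU S Q a (c • φ) = c • integratedOU S Q a φ := by
  ext x
  simp only [integratedOU, ou_smul, Pi.smul_apply, intervalIntegral.integral_smul]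

/-- For a trigonometric polynomial `p` with frequencies in `D(A*)`, the function
`∫_0^a R_s p ds` lies in `I_A(H)`, and `L` maps it to `R_a p - p`. -/
theorem HasGaussians.integratedOU_trigSpan (hN : HasGaussians S Q) (hQ : Q.IsPositive)
    {p : H → ℝ} (hp : p ∈ trigSpan S.adjDom) {a : ℝ} (ha : 0 ≤ a) :
    integratedOU S Q a p ∈ IA S Q ∧
      HasGen (ouSemigroup S Q) (integratedOU S Q a p) (ouSemigroup S Q a p - p) := by
  refine (trigSpan_induction (p := fun p => p ∈ trigSpan S.adjDom ∧
    integratedOU S Q a p ∈ IA S Q ∧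
      HasGen (ouSemigroup S Q) (integratedOU S Q a p) (ouSemigroup S Q a p - p))
    ?_ (fun φ ψ h1 h2 => ?_) (fun c φ h => ?_) (fun θ h hh => ?_) hp).2
  · have e : ouSemigroup S Q a 0 - 0 = 0 := by ext x; simp [ouSemigroup]
    rw [integratedOU_zero, e]
    exact ⟨zero_mem _, zero_mem _, hasGen_zero⟩
  · have c1 := trigSpan_subset_Cb h1.1
    have c2 := trigSpan_subset_Cb h2.1
    rw [hN.integratedOU_add c1 c2 (hN.measurableOrbits_trigSpan h1.1)
      (hN.measurableOrbits_trigSpan h2.1) ha, hN.ou_add ha c1 c2, add_sub_add_comm]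
    exact ⟨add_mem h1.1 h2.1, add_mem h1.2.1 h2.2.1, hN.hasGen_add h1.2.2 h2.2.2⟩
  · rw [integratedOU_smul, ou_smul, ← smul_sub]
    exact ⟨Submodule.smul_mem _ _ h.1, Submodule.smul_mem _ _ h.2.1, hasGen_smul c h.2.2⟩
  · rw [hN.integratedOU_trig θ h ha, hN.ou_trig ha]
    exact ⟨trig_mem_trigSpan θ hh, cosInt_mem_IA S Q θ ha hh, hN.hasGen_cosInt hQ θ h ha⟩

/-- The averages `k ∫_0^{1/k} R_s φ ds`, indexed by `k + 2`. -/
def averageOU (S : C0Semigroup H) (Q : H →L[ℝ] H) (k : ℕ) (φ : H → ℝ) : H → ℝ :=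
  ((k : ℝ) + 2) • integratedOU S Q (((k : ℝ) + 2)⁻¹) φ

theorem tendsto_inv_add_two :
    Tendsto (fun k : ℕ => ((k : ℝ) + 2)⁻¹) atTop (𝓝[>] 0) := by
  refine tendsto_nhdsWithin_iff.2 ⟨?_, Eventually.of_forall fun k => ?_⟩
  · exact tendsto_inv_atTop_zero.comp
      (tendsto_atTop_add_const_right _ _ tendsto_natCast_atTop_atTop)
  · exact Set.mem_Ioi.2 (by positivity)

/-- The shift by 2 puts the times strictly inside (0,1), even for k = 0, where `genDomain` bounds
the difference quotients. -/
theorem inv_add_two_mem (k : ℕ) : ((k : ℝ) + 2)⁻¹ ∈ Set.Ioo (0 : ℝ) 1 :=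
  ⟨by positivity, inv_lt_one_of_one_lt₀ (by linarith [(Nat.cast_nonneg k : (0 : ℝ) ≤ k)])⟩

theorem HasGaussians.averageOU_mem_Cb (hN : HasGaussians S Q) {φ : H → ℝ} (hφ : φ ∈ Cb H)
    (hm : MeasurableOrbits S Q φ) (k : ℕ) : averageOU S Q k φ ∈ Cb H :=
  smul_mem_Cb _ (hN.integratedOU_mem_Cb hφ hm (inv_add_two_mem k).1.le)

omit [BorelSpace H] in
theorem HasGaussians.abs_averageOU_le (hN : HasGaussians S Q) {φ : H → ℝ} {C : ℝ}
    (hC : ∀ x, |φ x| ≤ C) (k : ℕ) (x : H) : |averageOU S Q k φ x| ≤ C := by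
  have h := hN.abs_integratedOU_le hC (inv_add_two_mem k).1.le x
  have hk : (0 : ℝ) < (k : ℝ) + 2 := by positivity
  rw [averageOU, Pi.smul_apply, smul_eq_mul, abs_mul, abs_of_pos hk]
  calc _ ≤ ((k : ℝ) + 2) * (C * ((k : ℝ) + 2)⁻¹) := by gcongr
    _ = C := by field_simp

/-- The averages of `φ` are π-convergent to `φ`, if the orbits are right continuous at `0`. -/
theorem HasGaussians.averageOU_tendsto (hN : HasGaussians S Q) {φ : H → ℝ} (hφ : φ ∈ Cb H)
    (hm : MeasurableOrbits S Q φ)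
    (h0 : ∀ x, Tendsto (fun s => ouSemigroup S Q s φ x) (𝓝[>] 0) (𝓝 (φ x))) :
    PiTendsto (fun k => averageOU S Q k φ) φ := by
  obtain ⟨C, hC⟩ := hφ.2
  refine ⟨hN.averageOU_mem_Cb hφ hm, hφ, fun x => ?_, C, hN.abs_averageOU_le hC⟩
  have h1 : HasDerivWithinAt (fun u => ∫ s in (0 : ℝ)..u, ouSemigroup S Q s φ x) (φ x)
      (Set.Ici 0) 0 :=
    intervalIntegral.integral_hasDerivWithinAt_of_tendsto_ae_right (by simp)
      (s := Set.Ici 0) (t := Set.Ioi 0) ⟨Set.Ioi 0, self_mem_nhdsWithin, hm x⟩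
      ((h0 x).mono_left inf_le_left)
  have h2 := h1.mono Set.Ioi_subset_Ici_self
  rw [hasDerivWithinAt_iff_tendsto_slope' (by simp)] at h2
  refine (h2.comp tendsto_inv_add_two).congr fun k => ?_
  simp [slope_def_module, averageOU, integratedOU]

theorem HasGaussians.averageOU_tendsto_of_trigSpan (hN : HasGaussians S Q) {V : Submodule ℝ H}
    {p : H → ℝ} (hp : p ∈ trigSpan V) : PiTendsto (fun k => averageOU S Q k p) p := by
  refine hN.averageOU_tendsto (trigSpan_subset_Cb hp) (hN.measurableOrbits_trigSpan hp) fun x => ?_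
  have h1 := (hN.continuousOn_orbit_trigSpan hp x) 0 Set.self_mem_Ici
  rw [ContinuousWithinAt, hN.ou_zero_trigSpan hp] at h1
  exact h1.mono_left (nhdsWithin_mono _ Set.Ioi_subset_Ici_self)

/-- On D(L) the orbits are right continuous at 0, since R_tφ - φ is t times a convergent quotient.
-/
theorem HasGaussians.averageOU_tendsto_of_hasGen (hN : HasGaussians S Q) {φ g : H → ℝ}
    (h : HasGen (ouSemigroup S Q) φ g) (hm : MeasurableOrbits S Q φ) :
    PiTendsto (fun k => averageOU S Q k φ) φ := by
  refine hN.averageOU_tendsto h.1 hm fun x => ?_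
  have h1 : Tendsto (fun t : ℝ => t) (𝓝[>] 0) (𝓝 0) := tendsto_nhdsWithin_of_tendsto_nhds tendsto_id
  have h2 := (h1.mul (h.2.2.1 x)).add_const (φ x)
  rw [zero_mul, zero_add] at h2
  refine h2.congr' ?_
  filter_upwards [self_mem_nhdsWithin] with t ht
  have : t ≠ 0 := ne_of_gt ht
  field_simp
  ring

theorem HasGaussians.averageOU_piTendsto (hN : HasGaussians S Q) {p : ℕ → H → ℝ} {f : H → ℝ}
    (hp : ∀ n, MeasurableOrbits S Q (p n)) (h : PiTendsto p f) (k : ℕ) :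
    PiTendsto (fun n => averageOU S Q k (p n)) (averageOU S Q k f) :=
  (hN.integratedOU_tendsto hp h (inv_add_two_mem k).1.le).const_smul _

theorem HasGaussians.averageOU_mem_IA (hN : HasGaussians S Q) (hQ : Q.IsPositive) {p : H → ℝ}
    (hp : p ∈ trigSpan S.adjDom) (k : ℕ) : averageOU S Q k p ∈ IA S Q :=
  Submodule.smul_mem _ _ (hN.integratedOU_trigSpan hQ hp (inv_add_two_mem k).1.le).1

theorem HasGaussians.gen_averageOU (hN : HasGaussians S Q) (hQ : Q.IsPositive) {p : H → ℝ}
    (hp : p ∈ trigSpan S.adjDom) (k : ℕ) : gen (ouSemigroup S Q) (averageOU S Q k p) =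
      ((k : ℝ) + 2) • (ouSemigroup S Q (((k : ℝ) + 2)⁻¹) p - p) :=
  (hasGen_smul _ (hN.integratedOU_trigSpan hQ hp (inv_add_two_mem k).1.le).2).gen_eq

variable [TopologicalSpace.SeparableSpace H]

/-- The inner limit shrinks the averaging interval for a fixed trigonometric polynomial; the outer
limit runs along polynomials approximating f. -/
theorem HasGaussians.isPiDense_IA (hN : HasGaussians S Q) (hQ : Q.IsPositive) :
    IsPiDense (IA S Q : Set (H → ℝ)) := by
  refine ⟨fun φ hφ => ?_, (piClosure_subset_Cb _).antisymm fun f hf => ?_⟩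
  · obtain ⟨g, hg⟩ := hN.exists_hasGen_of_mem_IA hQ hφ
    exact hg.1
  · obtain ⟨p, hp, hpf⟩ := exists_trigSpan_piTendsto S.dense_adjDom hf
    exact ⟨2, two_pos, fun ν => averageOU S Q (ν 1) (p (ν 0)),
      fun ν => hN.averageOU_mem_IA hQ (hp _) _,
      multiPiTendsto_two (F := fun n k => averageOU S Q k (p n))
        (fun n => hN.averageOU_tendsto_of_trigSpan (hp n)) hpf⟩

/-- The order of limits is opposite to that for density: first the polynomials tend to φ with the
averaging interval fixed, then the interval shrinks. With the interval fixed, the images under L are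
differences R_t p - p up to a factor and pass to the π-limit. What remains is the difference
quotient of φ, controlled by φ ∈ D(L). -/
theorem HasGaussians.isPiCore_IA (hN : HasGaussians S Q) (hQ : Q.IsPositive) :
    IsPiCore (ouSemigroup S Q) (IA S Q : Set (H → ℝ)) := by
  refine ⟨fun φ hφ => ?_, hN.isPiDense_IA hQ, fun φ hφ => ?_⟩
  · obtain ⟨g, hg⟩ := hN.exists_hasGen_of_mem_IA hQ hφ
    exact hg.mem_genDomain
  · have hg := exists_hasGen_of_mem_genDomain hφ
    obtain ⟨p, hp, hpf⟩ := exists_trigSpan_piTendsto S.dense_adjDom hφ.1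
    have hmp := fun n => hN.measurableOrbits_trigSpan (hp n)
    have hm := hN.measurableOrbits_of_piTendsto hmp hpf
    refine ⟨2, two_pos, fun ν => averageOU S Q (ν 0) (p (ν 1)),
      fun ν => hN.averageOU_mem_IA hQ (hp _) _,
      multiPiTendsto_two (F := fun k n => averageOU S Q k (p n))
        (hN.averageOU_piTendsto hmp hpf) (hN.averageOU_tendsto_of_hasGen hg hm), ?_⟩
    refine multiPiTendsto_two (F := fun k n => gen (ouSemigroup S Q) (averageOU S Q k (p n)))
      (G := fun k : ℕ => ((k : ℝ) + 2) • (ouSemigroup S Q (((k : ℝ) + 2)⁻¹) φ - φ))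
      (fun k => ?_) ?_
    · simp only [hN.gen_averageOU hQ (hp _)]
      exact ((hN.ou_tendsto (inv_add_two_mem k).1.le hpf).sub hpf).const_smul _
    · obtain ⟨C, hC⟩ := hg.2.2.2
      have e : ∀ (k : ℕ) x, (((k : ℝ) + 2) • (ouSemigroup S Q (((k : ℝ) + 2)⁻¹) φ - φ)) x =
          (ouSemigroup S Q (((k : ℝ) + 2)⁻¹) φ x - φ x) / ((k : ℝ) + 2)⁻¹ := fun k x => by
        rw [Pi.smul_apply, Pi.sub_apply, smul_eq_mul, div_inv_eq_mul, mul_comm]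
      refine ⟨fun k => smul_mem_Cb _ (sub_mem_Cb (hN.ou_mem_Cb (inv_add_two_mem k).1.le hφ.1) hφ.1),
        hg.2.1, fun x => ?_, C, fun k x => ?_⟩
      · simp only [e]
        exact (hg.2.2.1 x).comp tendsto_inv_add_two
      · refine (congrArg abs (e k x)).trans_le ?_
        exact hC _ (inv_add_two_mem k) x

end PiCore

/-! ### Integrals of rank one operators: trace and differentiation. -/

section RankOneIntegrals

variable {H : Type u} [NormedAddCommGroup H] [InnerProductSpace ℝ H]

/-- Orthonormal vectors are √2 apart, so balls of radius 1/2 around them are disjoint. Countability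
is needed to exchange a basis sum with an integral. -/
theorem countable_of_orthonormal [TopologicalSpace.SeparableSpace H] {ι : Type*} {e : ι → H}
    (he : Orthonormal ℝ e) : Countable ι := by
  refine Set.countable_univ_iff.1 (Set.PairwiseDisjoint.countable_of_isOpen
    (s := fun i => Metric.ball (e i) (1 / 2)) (fun i _ j _ hij => ?_)
    (fun i _ => Metric.isOpen_ball) (fun i _ => ⟨e i, Metric.mem_ball_self (by norm_num)⟩))
  refine Metric.ball_disjoint_ball ?_
  have h1 : ‖e i - e j‖ ^ 2 = 2 := by
    rw [@norm_sub_sq_real, he.1 i, he.1 j, he.2 hij]; norm_num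
  rw [dist_eq_norm]
  nlinarith [norm_nonneg (e i - e j)]

variable {a : ℝ} {c : ℝ → ℝ} {k l : ℝ → H}

theorem intervalIntegrable_of_continuousOn_Icc {E : Type*} [NormedAddCommGroup E] {f : ℝ → E}
    (ha : 0 ≤ a) (hf : ContinuousOn f (Set.Icc 0 a)) : IntervalIntegrable f volume 0 a :=
  ContinuousOn.intervalIntegrable (by rwa [Set.uIcc_of_le ha])

/-- Integrals of continuous families of rank one operators are of trace class. -/
theorem isTraceClass_integral [CompleteSpace H] (ha : 0 ≤ a) (hc : ContinuousOn c (Set.Icc 0 a))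
    (hk : ContinuousOn k (Set.Icc 0 a)) (hl : ContinuousOn l (Set.Icc 0 a)) :
    IsTraceClass fun z => ∫ s in (0 : ℝ)..a, (c s * ⟪k s, z⟫) • l s := by
  intro ι e f he hf
  have hT : ∀ i, ⟪∫ s in (0 : ℝ)..a, (c s * ⟪k s, e i⟫) • l s, f i⟫ =
      ∫ s in (0 : ℝ)..a, c s * ⟪k s, e i⟫ * ⟪l s, f i⟫ := fun i => by
    rw [real_inner_comm]
    refine ((innerSL ℝ (f i)).intervalIntegral_comp_comm
      (intervalIntegrable_of_continuousOn_Icc ha (by fun_prop))).symm.trans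
      (intervalIntegral.integral_congr fun s _ => ?_)
    simp only [innerSL_apply_apply, real_inner_smul_right]
    rw [real_inner_comm (f i)]
  simp only [hT]
  -- The inequality |uv| ≤ (u² + v²)/2 and Bessel for both families give a bound independent of the
  -- finite set.
  refine summable_of_sum_le (c := ∫ s in (0 : ℝ)..a, |c s| * ((‖k s‖ ^ 2 + ‖l s‖ ^ 2) / 2))
    (fun i => abs_nonneg _) fun u => ?_
  calc ∑ i ∈ u, |∫ s in (0 : ℝ)..a, c s * ⟪k s, e i⟫ * ⟪l s, f i⟫|
      ≤ ∑ i ∈ u, ∫ s in (0 : ℝ)..a, |c s * ⟪k s, e i⟫ * ⟪l s, f i⟫| :=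
        Finset.sum_le_sum fun i _ => intervalIntegral.abs_integral_le_integral_abs ha
    _ = ∫ s in (0 : ℝ)..a, ∑ i ∈ u, |c s * ⟪k s, e i⟫ * ⟪l s, f i⟫| :=
        (intervalIntegral.integral_finsetSum fun i _ =>
          intervalIntegrable_of_continuousOn_Icc ha (by fun_prop)).symm
    _ ≤ _ := by
        refine intervalIntegral.integral_mono_on ha
          (intervalIntegrable_of_continuousOn_Icc ha (by fun_prop))
          (intervalIntegrable_of_continuousOn_Icc ha (by fun_prop)) fun s _ => ?_
        have h1 := he.sum_inner_products_le (s := u) (k s)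
        have h2 := hf.sum_inner_products_le (s := u) (l s)
        calc ∑ i ∈ u, |c s * ⟪k s, e i⟫ * ⟪l s, f i⟫|
            ≤ ∑ i ∈ u, |c s| * ((‖⟪e i, k s⟫‖ ^ 2 + ‖⟪f i, l s⟫‖ ^ 2) / 2) := by
              refine Finset.sum_le_sum fun i _ => ?_
              rw [abs_mul, abs_mul, mul_assoc, Real.norm_eq_abs, Real.norm_eq_abs,
                real_inner_comm (e i), real_inner_comm (f i)]
              gcongr
              nlinarith [sq_nonneg (|⟪e i, k s⟫| - |⟪f i, l s⟫|)]
          _ = |c s| * ((∑ i ∈ u, ‖⟪e i, k s⟫‖ ^ 2 + ∑ i ∈ u, ‖⟪f i, l s⟫‖ ^ 2) / 2) := by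
              rw [← Finset.mul_sum, ← Finset.sum_div, Finset.sum_add_distrib]
          _ ≤ _ := by gcongr

/-- Parseval under the integral sign; the dominating series of half sums of squares has a
continuous, hence integrable, sum. -/
theorem hasSum_inner_integral [CompleteSpace H] [TopologicalSpace.SeparableSpace H] {ι : Type*}
    (b : HilbertBasis ι ℝ H) (ha : 0 ≤ a) (hc : ContinuousOn c (Set.Icc 0 a))
    (hk : ContinuousOn k (Set.Icc 0 a)) (hl : ContinuousOn l (Set.Icc 0 a)) :
    HasSum (fun i => ⟪∫ s in (0 : ℝ)..a, (c s * ⟪k s, b i⟫) • l s, b i⟫)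
      (∫ s in (0 : ℝ)..a, c s * ⟪k s, l s⟫) := by
  have := countable_of_orthonormal b.orthonormal
  have hT : ∀ i, ⟪∫ s in (0 : ℝ)..a, (c s * ⟪k s, b i⟫) • l s, b i⟫ =
      ∫ s in (0 : ℝ)..a, c s * (⟪k s, b i⟫ * ⟪b i, l s⟫) := fun i => by
    rw [real_inner_comm]
    refine ((innerSL ℝ (b i)).intervalIntegral_comp_comm
      (intervalIntegrable_of_continuousOn_Icc ha (by fun_prop))).symm.trans
      (intervalIntegral.integral_congr fun s _ => ?_)
    simp only [innerSL_apply_apply, real_inner_smul_right]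
    ring
  simp only [hT]
  have hsq : ∀ v : H, HasSum (fun i => ⟪v, b i⟫ * ⟪b i, v⟫) (‖v‖ ^ 2) := fun v => by
    rw [← real_inner_self_eq_norm_sq]
    exact b.hasSum_inner_mul_inner v v
  have hB : ∀ s, HasSum (fun i => |c s| * ((⟪k s, b i⟫ * ⟪b i, k s⟫ + ⟪l s, b i⟫ * ⟪b i, l s⟫) / 2))
      (|c s| * ((‖k s‖ ^ 2 + ‖l s‖ ^ 2) / 2)) := fun s =>
    (((hsq (k s)).add (hsq (l s))).div_const 2).mul_left _
  refine intervalIntegral.hasSum_integral_of_dominated_convergence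
    (fun i s => |c s| * ((⟪k s, b i⟫ * ⟪b i, k s⟫ + ⟪l s, b i⟫ * ⟪b i, l s⟫) / 2))
    (fun i => ?_) (fun i => ae_of_all _ fun s _ => ?_) (ae_of_all _ fun s _ => (hB s).summable) ?_
    (ae_of_all _ fun s _ => (b.hasSum_inner_mul_inner (k s) (l s)).mul_left _)
  · have : ContinuousOn (fun s => c s * (⟪k s, b i⟫ * ⟪b i, l s⟫)) (Set.Icc 0 a) := by fun_prop
    rw [Set.uIoc_of_le ha]
    exact (this.mono Set.Ioc_subset_Icc_self).aestronglyMeasurable measurableSet_Ioc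
  · rw [Real.norm_eq_abs, abs_mul, abs_mul]
    gcongr
    rw [real_inner_comm (k s), real_inner_comm (b i) (l s)]
    nlinarith [sq_nonneg (|⟪k s, b i⟫| - |⟪b i, l s⟫|), sq_abs ⟪k s, b i⟫, sq_abs ⟪b i, l s⟫]
  · simp only [fun s => (hB s).tsum_eq]
    exact intervalIntegrable_of_continuousOn_Icc ha (by fun_prop)

/-- Differentiation under the integral sign for superpositions of ridge functions. -/
theorem hasFDerivAt_integral_ridge {E : Type*} [NormedAddCommGroup E] [NormedSpace ℝ E]
    [CompleteSpace E] {f f' : ℝ → ℝ} (hf : ∀ r, HasDerivAt f (f' r) r) (hf' : Continuous f')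
    (hb : ∀ r, |f' r| ≤ 1) (θ : ℝ) {v : ℝ → E} (ha : 0 ≤ a) (hk : ContinuousOn k (Set.Icc 0 a))
    (hv : ContinuousOn v (Set.Icc 0 a)) (x : H) :
    ∃ D : H →L[ℝ] E, HasFDerivAt (fun x => ∫ s in (0 : ℝ)..a, f (⟪x, k s⟫ + θ) • v s) D x ∧
      ∀ z, D z = ∫ s in (0 : ℝ)..a, (f' (⟪x, k s⟫ + θ) * ⟪k s, z⟫) • v s := by
  have hfc : Continuous f := continuous_iff_continuousAt.2 fun r => (hf r).continuousAt
  let F' : H → ℝ → H →L[ℝ] E := fun x s =>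
    f' (⟪x, k s⟫ + θ) • (innerSL ℝ (k s)).smulRight (v s)
  have hF'c : ∀ x, ContinuousOn (F' x) (Set.Icc 0 a) := fun x => by
    have h1 : ContinuousOn (fun s => (innerSL ℝ (k s)).smulRight (v s)) (Set.Icc 0 a) :=
      (ContinuousLinearMap.smulRightL ℝ H E).continuous₂.comp_continuousOn
        (((innerSL ℝ).continuous.comp_continuousOn hk).prodMk hv)
    have h2 : ContinuousOn (fun s => f' (⟪x, k s⟫ + θ)) (Set.Icc 0 a) := by fun_prop
    exact h2.smul h1
  have hFc : ∀ x, ContinuousOn (fun s => f (⟪x, k s⟫ + θ) • v s) (Set.Icc 0 a) := fun x => by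
    fun_prop
  refine ⟨∫ s in (0 : ℝ)..a, F' x s, ?_, fun z => ?_⟩
  · refine intervalIntegral.hasFDerivAt_integral_of_dominated_of_fderiv_le (s := Set.univ)
      (F := fun x s => f (⟪x, k s⟫ + θ) • v s) (F' := F') (bound := fun s => ‖k s‖ * ‖v s‖)
      univ_mem (Eventually.of_forall fun x => ?_)
      (intervalIntegrable_of_continuousOn_Icc ha (hFc x)) ?_ (ae_of_all _ fun s _ y _ => ?_)
      (intervalIntegrable_of_continuousOn_Icc ha (by fun_prop)) (ae_of_all _ fun s _ y _ => ?_)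
    · exact (intervalIntegrable_of_continuousOn_Icc ha (hFc x)).def'.aestronglyMeasurable
    · exact (intervalIntegrable_of_continuousOn_Icc ha (hF'c x)).def'.aestronglyMeasurable
    · rw [norm_smul, ContinuousLinearMap.norm_smulRight_apply, innerSL_apply_norm]
      exact mul_le_of_le_one_left (by positivity) (hb _)
    · have h1 : HasFDerivAt (fun x : H => ⟪x, k s⟫ + θ) (innerSL ℝ (k s)) y := by
        have : (fun x : H => ⟪x, k s⟫ + θ) = fun x => innerSL ℝ (k s) x + θ := by
          ext x; rw [innerSL_apply_apply, real_inner_comm]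
        rw [this]
        exact (innerSL ℝ (k s)).hasFDerivAt.add_const θ
      refine (((hf _).comp_hasFDerivAt y h1).smul_const (v s)).congr_fderiv ?_
      ext z
      simp [F', mul_smul]
  · rw [ContinuousLinearMap.intervalIntegral_apply
      (intervalIntegrable_of_continuousOn_Icc ha (hF'c x))]
    refine intervalIntegral.integral_congr fun s _ => ?_
    simp [F', mul_smul]

end RankOneIntegrals

/-! ### Linear combinations of trace class operators. -/

section TraceClass

variable {H : Type u} [NormedAddCommGroup H] [InnerProductSpace ℝ H]

theorem IsTraceClass.add {T T' : H → H} (hT : IsTraceClass T) (hT' : IsTraceClass T') :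
    IsTraceClass fun z => T z + T' z := fun ι e f he hf =>
  Summable.of_nonneg_of_le (fun _ => abs_nonneg _)
    (fun i => by rw [inner_add_left]; exact abs_add_le _ _) ((hT ι e f he hf).add (hT' ι e f he hf))

theorem IsTraceClass.const_smul {T : H → H} (hT : IsTraceClass T) (c : ℝ) :
    IsTraceClass fun z => c • T z := fun ι e f he hf => by
  simpa only [real_inner_smul_left, abs_mul] using (hT ι e f he hf).mul_left |c|

end TraceClass

/-! ### Regularity of I_A(H) and the explicit formula for L. -/

section Regularity

variable {H : Type u} [NormedAddCommGroup H] [InnerProductSpace ℝ H] [CompleteSpace H]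
  (S : C0Semigroup H) (Q : H →L[ℝ] H)

/-- Because h ∈ D(A*), the derivative exists for every x, not only for x ∈ D(A). -/
theorem C0Semigroup.hasDerivAt_inner_adj (h : S.adjDom) (x : H) {t : ℝ} (ht : 0 < t) :
    HasDerivAt (fun s => ⟪x, S.adj s h⟫) ⟪x, S.adj t (S.generator.adjoint h)⟫ t := by
  have hc : ContinuousOn (fun s => ⟪x, S.adj s (S.generator.adjoint h)⟫) (Set.Ici 0) :=
    continuousOn_const.inner (S.continuousOn_adj _)
  have h1 : HasDerivAt (fun u => ∫ s in (0 : ℝ)..u, ⟪x, S.adj s (S.generator.adjoint h)⟫)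
      ⟪x, S.adj t (S.generator.adjoint h)⟫ t :=
    intervalIntegral.integral_hasDerivAt_right
      (intervalIntegrable_of_continuousOn_Ici hc le_rfl ht.le)
      ⟨Set.Ici 0, Ici_mem_nhds ht, hc.aestronglyMeasurable measurableSet_Ici⟩
      (hc.continuousAt (Ici_mem_nhds ht))
  refine (h1.add_const ⟪x, (h : H)⟫).congr_of_eventuallyEq ?_
  filter_upwards [Ici_mem_nhds ht] with s hs
  have h2 := S.inner_op_sub_self h x hs
  simp only [← S.inner_adj_right] at h2
  rw [inner_sub_left, ← S.inner_adj_right] at h2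
  linarith

/-- The Kolmogorov equation for one cosine: differentiating the exponential factor gives ½Tr[QD²],
and differentiating the phase gives ⟨x,A*D⟩. -/
theorem hasDerivAt_dampedCos (θ : ℝ) (h : S.adjDom) (x : H) {t : ℝ} (ht : 0 < t) :
    HasDerivAt (fun s => dampedCos S Q θ h s x)
      (1 / 2 * (-(Real.cos (⟪x, S.adj t h⟫ + θ)) * Real.exp (-covForm S Q t h / 2) *
          ⟪S.adj t h, Q (S.adj t h)⟫) +
        -Real.sin (⟪x, S.adj t h⟫ + θ) * (Real.exp (-covForm S Q t h / 2) *
          ⟪x, S.adj t (S.generator.adjoint h)⟫)) t := by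
  have h1 := ((hasDerivAt_covForm S Q h ht).neg.div_const 2).exp
  have h2 := ((S.hasDerivAt_inner_adj h x ht).add_const θ).cos
  refine (h1.mul h2).congr_deriv ?_
  rw [real_inner_comm (S.adj t h)]
  simp only [Pi.neg_apply]
  ring

variable {S Q}

/-- The regularity of the functions in `I_A(H)`, together with the formula for the generator;
the trace is expressed as a sum over the orthonormal basis `b`. -/
def HasRegularity [MeasurableSpace H] (S : C0Semigroup H) (Q : H →L[ℝ] H) {ι : Type*}
    (b : HilbertBasis ι ℝ H) (φ : H → ℝ) : Prop :=
  ∃ (g : H → ℝ) (G : H → H) (D : H → H →L[ℝ] H) (W : H → H) (τ : H → ℝ),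
    HasGen (ouSemigroup S Q) φ g ∧ (∀ x, HasGradientAt φ (G x) x) ∧
    (∀ x, HasFDerivAt G (D x) x) ∧ (∀ x, IsTraceClass fun z => Q (D x z)) ∧
    (∀ x, HasSum (fun i => ⟪Q (D x (b i)), b i⟫) (τ x)) ∧
    (∀ x (y : S.domain), ⟪W x, y⟫ = ⟪G x, S.generator y⟫) ∧
    ∀ x, g x = 1 / 2 * τ x + ⟪x, W x⟫

variable [MeasurableSpace H] [BorelSpace H] {ι : Type*} {b : HilbertBasis ι ℝ H}

omit [BorelSpace H] in
theorem hasRegularity_zero : HasRegularity S Q b 0 :=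
  ⟨0, 0, 0, 0, 0, hasGen_zero, fun x => hasGradientAt_const x 0, fun x => hasFDerivAt_const 0 x,
    fun x ι e f _ _ => by simp, fun x => by simp,
    by simp, by simp⟩

theorem HasGaussians.hasRegularity_add (hN : HasGaussians S Q) {φ ψ : H → ℝ}
    (hφ : HasRegularity S Q b φ) (hψ : HasRegularity S Q b ψ) : HasRegularity S Q b (φ + ψ) := by
  obtain ⟨g, G, D, W, τ, h1, h2, h3, h4, h5, h6, h7⟩ := hφ
  obtain ⟨g', G', D', W', τ', h1', h2', h3', h4', h5', h6', h7'⟩ := hψ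
  refine ⟨g + g', G + G', D + D', W + W', τ + τ', hN.hasGen_add h1 h1', fun x => ?_,
    fun x => (h3 x).add (h3' x), fun x => ?_, fun x => ?_, fun x y => ?_, fun x => ?_⟩
  · rw [hasGradientAt_iff_hasFDerivAt, Pi.add_apply, map_add]
    exact (h2 x).hasFDerivAt.add (h2' x).hasFDerivAt
  · simpa using (h4 x).add (h4' x)
  · simpa [inner_add_left] using (h5 x).add (h5' x)
  · simp [inner_add_left, h6, h6']
  · simp only [Pi.add_apply, h7, h7', inner_add_right]; ring

omit [BorelSpace H] in
theorem hasRegularity_smul (c : ℝ) {φ : H → ℝ} (hφ : HasRegularity S Q b φ) :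
    HasRegularity S Q b (c • φ) := by
  obtain ⟨g, G, D, W, τ, h1, h2, h3, h4, h5, h6, h7⟩ := hφ
  refine ⟨c • g, c • G, c • D, c • W, c • τ, hasGen_smul c h1, fun x => ?_,
    fun x => (h3 x).const_smul c, fun x => ?_, fun x => ?_, fun x y => ?_, fun x => ?_⟩
  · rw [hasGradientAt_iff_hasFDerivAt, Pi.smul_apply, map_smul]
    exact (h2 x).hasFDerivAt.const_smul c
  · simpa using (h4 x).const_smul c
  · simpa [real_inner_smul_left] using (h5 x).mul_left c
  · simp [real_inner_smul_left, h6]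
  · simp only [Pi.smul_apply, h7, real_inner_smul_right, smul_eq_mul]; ring

theorem HasGaussians.hasRegularity_cosInt [TopologicalSpace.SeparableSpace H]
    (hN : HasGaussians S Q) (hQ : Q.IsPositive) (θ : ℝ) {a : ℝ} (ha : 0 < a) {h : H}
    (hh : h ∈ S.adjDom) : HasRegularity S Q b (cosInt S Q θ h a) := by
  set A : H := S.generator.adjoint (⟨h, hh⟩ : S.adjDom) with hA
  let w : ℝ → ℝ := fun s => Real.exp (-covForm S Q s h / 2)
  have hwc : ContinuousOn w (Set.Icc 0 a) := by
    have h1 : ContinuousOn (fun s => covForm S Q s h) (Set.Icc 0 a) :=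
      (continuousOn_covForm S Q h).mono Set.Icc_subset_Ici_self
    fun_prop
  have hk : ContinuousOn (fun s => S.adj s h) (Set.Icc 0 a) :=
    (S.continuousOn_adj h).mono Set.Icc_subset_Ici_self
  have hkA : ContinuousOn (fun s => S.adj s A) (Set.Icc 0 a) :=
    (S.continuousOn_adj A).mono Set.Icc_subset_Ici_self
  have hwk : ContinuousOn (fun s => w s • S.adj s h) (Set.Icc 0 a) := hwc.smul hk
  let G : H → H := fun x =>
    ∫ s in (0 : ℝ)..a, -Real.sin (⟪x, S.adj s h⟫ + θ) • w s • S.adj s h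
  let W : H → H := fun x =>
    ∫ s in (0 : ℝ)..a, -Real.sin (⟪x, S.adj s h⟫ + θ) • w s • S.adj s A
  -- The ridge lemma is applied twice: with f = cos and scalar weights for the first derivative,
  -- then with f = -sin and the vectors w(s)e^{sA*}h for the derivative of the gradient.
  choose D1 hD1 hD1' using hasFDerivAt_integral_ridge (k := fun s => S.adj s h)
    Real.hasDerivAt_cos (by fun_prop) (fun r => by simpa using Real.abs_sin_le_one r) θ ha.le hk hwc
  choose D hD hD' using hasFDerivAt_integral_ridge (k := fun s => S.adj s h) (f := fun r => -Real.sin r)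
    (fun r => (Real.hasDerivAt_sin r).neg) (by fun_prop)
    (fun r => by simpa using Real.abs_cos_le_one r) θ ha.le hk hwk
  let c : H → ℝ → ℝ := fun x s => -Real.cos (⟪x, S.adj s h⟫ + θ) * w s
  have hc : ∀ x, ContinuousOn (c x) (Set.Icc 0 a) := fun x => by
    have h1 : ContinuousOn (fun s => -Real.cos (⟪x, S.adj s h⟫ + θ)) (Set.Icc 0 a) := by fun_prop
    exact h1.mul hwc
  have hQk : ContinuousOn (fun s => Q (S.adj s h)) (Set.Icc 0 a) := by fun_prop
  have hGi : ∀ x, IntervalIntegrable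
      (fun s => -Real.sin (⟪x, S.adj s h⟫ + θ) • w s • S.adj s h) volume 0 a := fun x =>
    intervalIntegrable_of_continuousOn_Icc ha.le (by fun_prop)
  have hWi : ∀ x, IntervalIntegrable
      (fun s => -Real.sin (⟪x, S.adj s h⟫ + θ) • w s • S.adj s A) volume 0 a := fun x =>
    intervalIntegrable_of_continuousOn_Icc ha.le (by fun_prop)
  have hGin : ∀ x z, ⟪z, G x⟫ =
      ∫ s in (0 : ℝ)..a, -Real.sin (⟪x, S.adj s h⟫ + θ) * (w s * ⟪z, S.adj s h⟫) := fun x z => by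
    refine ((innerSL ℝ z).intervalIntegral_comp_comm (hGi x)).symm.trans
      (intervalIntegral.integral_congr fun s _ => ?_)
    simp only [innerSL_apply_apply, real_inner_smul_right]
  have hWin : ∀ x z, ⟪z, W x⟫ =
      ∫ s in (0 : ℝ)..a, -Real.sin (⟪x, S.adj s h⟫ + θ) * (w s * ⟪z, S.adj s A⟫) := fun x z => by
    refine ((innerSL ℝ z).intervalIntegral_comp_comm (hWi x)).symm.trans
      (intervalIntegral.integral_congr fun s _ => ?_)
    simp only [innerSL_apply_apply, real_inner_smul_right]
  have hQD : ∀ x z, Q (D x z) =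
      ∫ s in (0 : ℝ)..a, (c x s * ⟪S.adj s h, z⟫) • Q (S.adj s h) := fun x z => by
    rw [hD']
    refine (Q.intervalIntegral_comp_comm
      (intervalIntegrable_of_continuousOn_Icc ha.le (by fun_prop))).symm.trans
      (intervalIntegral.integral_congr fun s _ => ?_)
    simp only [map_smul, smul_smul, c]
    congr 1; ring
  refine ⟨_, G, D, W, fun x => ∫ s in (0 : ℝ)..a, c x s * ⟪S.adj s h, Q (S.adj s h)⟫,
    hN.hasGen_cosInt hQ θ h ha.le, fun x => ?_, hD, fun x => ?_, fun x => ?_, fun x y => ?_,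
    fun x => ?_⟩
  · rw [hasGradientAt_iff_hasFDerivAt]
    have e : cosInt S Q θ h a =
        fun x => ∫ s in (0 : ℝ)..a, Real.cos (⟪x, S.adj s h⟫ + θ) • w s := by
      ext x
      simp only [cosInt, dampedCos, smul_eq_mul, w, mul_comm]
    rw [e]
    refine (hD1 x).congr_fderiv ?_
    ext z
    rw [hD1', InnerProductSpace.toDual_apply_apply, real_inner_comm, hGin]
    refine intervalIntegral.integral_congr fun s _ => ?_
    simp only [smul_eq_mul]
    rw [real_inner_comm z]; ring
  · simp only [hQD]
    exact isTraceClass_integral ha.le (hc x) hk hQk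
  · simp only [hQD]
    exact hasSum_inner_integral b ha.le (hc x) hk hQk
  -- For y ∈ D(A), ⟨y, e^{sA*}A*h⟩ = ⟨Ay, e^{sA*}h⟩ holds under the integral. This weak form puts
  -- the gradient in D(A*) with image W, without integrating A* itself.
  · rw [real_inner_comm, hWin, real_inner_comm, hGin]
    refine intervalIntegral.integral_congr fun s hs => ?_
    rw [Set.uIcc_of_le ha.le] at hs
    have key : ⟪(y : H), S.adj s A⟫ = ⟪S.generator y, S.adj s h⟫ :=
      (real_inner_comm _ _).trans
        ((S.inner_adj_adjoint ⟨h, hh⟩ hs.1 y).trans (real_inner_comm _ _))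
    simp only [key]
  · have hi1 : IntervalIntegrable (fun s => 1 / 2 * (c x s * ⟪S.adj s h, Q (S.adj s h)⟫))
        volume 0 a := by
      have := hc x
      exact intervalIntegrable_of_continuousOn_Icc ha.le (by fun_prop)
    have hi2 : IntervalIntegrable
        (fun s => -Real.sin (⟪x, S.adj s h⟫ + θ) * (w s * ⟪x, S.adj s A⟫)) volume 0 a :=
      intervalIntegrable_of_continuousOn_Icc ha.le (by fun_prop)
    -- The fundamental theorem of calculus on [0,a], with the derivative known in the open interval
    -- and continuity at the ends, identifies the integrated Kolmogorov operator with the value R_a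
    -- p - p of the generator.
    have h1 := intervalIntegral.integral_eq_sub_of_hasDerivAt_of_le ha.le
      ((continuousOn_dampedCos S Q θ h x).mono Set.Icc_subset_Ici_self)
      (fun s hs => hasDerivAt_dampedCos S Q θ ⟨h, hh⟩ x hs.1) (hi1.add hi2)
    rw [hWin, ← intervalIntegral.integral_const_mul, ← intervalIntegral.integral_add hi1 hi2]
    rw [Pi.sub_apply, ← dampedCos_zero S Q]
    exact h1.symm

theorem HasGaussians.hasRegularity_of_mem_IA [TopologicalSpace.SeparableSpace H]
    (hN : HasGaussians S Q) (hQ : Q.IsPositive) {φ : H → ℝ} (hφ : φ ∈ IA S Q) :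
    HasRegularity S Q b φ :=
  IA_induction hasRegularity_zero (fun _ _ => hN.hasRegularity_add)
    (fun c _ => hasRegularity_smul c)
    (fun θ _ ha _ hh => hN.hasRegularity_cosInt hQ θ ha hh) hφ

end Regularity
end OrnsteinUhlenbeck

end

/-! ### The main theorem. -/

open OrnsteinUhlenbeck

theorem proposition3p12 {H : Type u} [NormedAddCommGroup H] [InnerProductSpace ℝ H]
    [CompleteSpace H] [TopologicalSpace.SeparableSpace H] [MeasurableSpace H] [BorelSpace H]
    (S : C0Semigroup H) (Q : H →L[ℝ] H) (hQ : Q.IsPositive)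
    (hQt : ∀ t : ℝ, 0 < t → IsTraceClass (covOp S Q t)) :
    IsPiDense (IA S Q : Set (H → ℝ)) ∧
    (∀ t : ℝ, 0 ≤ t → ∀ φ ∈ IA S Q, ouSemigroup S Q t φ ∈ IA S Q) ∧
    (IA S Q : Set (H → ℝ)) ⊆ genDomain (ouSemigroup S Q) ∧
    IsPiCore (ouSemigroup S Q) (IA S Q : Set (H → ℝ)) ∧
    ∀ φ ∈ IA S Q, Differentiable ℝ φ ∧ Differentiable ℝ (gradient φ) ∧
      ∀ x : H, IsTraceClass (fun z => Q (fderiv ℝ (gradient φ) x z)) ∧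
        ∃ hx : gradient φ x ∈ S.generator.adjoint.domain,
          gen (ouSemigroup S Q) φ x =
            1 / 2 * trace (fun z => Q (fderiv ℝ (gradient φ) x z)) +
              ⟪x, S.generator.adjoint ⟨gradient φ x, hx⟩⟫ := by
  have : SecondCountableTopology H := UniformSpace.secondCountable_of_separable H
  have hN : HasGaussians S Q := hasGaussians_of_isTraceClass hQ hQt
  have hcore := hN.isPiCore_IA hQ
  refine ⟨hcore.2.1, fun t ht φ hφ => hN.ou_mem_IA hQ ht hφ, hcore.1, hcore, fun φ hφ => ?_⟩
  -- The basis is the one chosen in the definition of `trace`, so the basis sum `τ` is that trace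
  -- without appeal to basis independence.
  obtain ⟨g, G, D, W, τ, hg, hG, hD, hT, hτ, hW, hgen⟩ := hN.hasRegularity_of_mem_IA
    (b := (exists_hilbertBasis ℝ H).choose_spec.choose) hQ hφ
  have hgrad : gradient φ = G := funext fun x => (hG x).gradient
  have hx : ∀ x, G x ∈ S.generator.adjoint.domain := fun x => S.mem_adjDom (W x) (hW x)
  rw [hgrad, hg.gen_eq]
  refine ⟨fun x => (hG x).differentiableAt, fun x => (hD x).differentiableAt, fun x => ?_⟩
  rw [(hD x).fderiv]
  refine ⟨hT x, hx x, ?_⟩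
  rw [hgen, S.adjoint_apply_eq (hx x) (hW x), trace, (hτ x).tsum_eq]
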